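/- Let $(M^m,g)$ be a smooth Riemannian manifold, $(N^{2n},J,h)$ a Kähler manifold of complex dimension $n$ (that is, a complex manifold with a Hermitian metric $h$ for which $\nabla^N J=0$), $V$ a smooth vector field on $M$, and $\varphi:M\to N$ a smooth submersion. For $x\in M$ let $d\varphi_x^*:T_{\varphi(x)}N\to T_xM$ be the adjoint of $d\varphi_x$ with respect to $g$ and $h$, and call $v\in T_xM$ horizontal if it is orthogonal to $\ker d\varphi_x$. Here $\nabla^M,\nabla^N$ are the Levi-Civita connections. Assume: 1. $\varphi$ is $V$-harmonic: $\tau(\varphi)+d\varphi(V)=0$, where $\tau(\varphi)=\operatorname{trace}_g\nabla d\varphi$ is the tension field of $\varphi$. 2. $\varphi$ is pseudo-horizontally homothetic (PHH): for every $x\in M$, $d\varphi_x\circ d\varphi_x^*$ commutes with $J_{\varphi(x)}$, and $$d\varphi_x\big(\nabla^M_v\, d\varphi^*(JY)\big)=J_{\varphi(x)}\,d\varphi_x\big(\nabla^M_v\, d\varphi^*(Y)\big)$$ for every horizontal $v\in T_xM$ and every smooth vector field $Y$ defined on a neighbourhood of $\varphi(x)$. Then for every embedded complex submanifold $P\subset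 N$ of complex dimension $p$, the preimage $K=\varphi^{-1}(P)$ is a $V$-minimal submanifold of $M$: it is (empty or) an embedded smooth submanifold of dimension $m-2n+2p$, and $$\operatorname{trace}(A)_x-V_x\in T_xK\qquad\text{for every }x\in K,$$ where $A(X,Y)=(\nabla^M_XY)^{\perp}$, for $X,Y$ tangent to $K$, is the second fundamental form of $K$ in $M$ (with values in $TK^\perp$). -/

import Mathlib

open Bundle Module Filter Topology FiberBundle
open scoped Manifold ContDiff InnerProductSpace

noncomputable section

namespace VMinimal

section LeviCivita

variable {E : Type*} [NormedAddCommGroup E] [NormedSpace ℝ E] [FiniteDimensional ℝ E]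
  {M : Type*} [TopologicalSpace M] [ChartedSpace E M]

instance instFiniteDimensionalTangentSpace (x : M) :
    FiniteDimensional ℝ (TangentSpace 𝓘(ℝ, E) x) :=
  inferInstanceAs (FiniteDimensional ℝ E)

variable [RiemannianBundle (fun x : M ↦ TangentSpace 𝓘(ℝ, E) x)]

/-- The right-hand side of the Koszul formula for `g(∇_X Y, Z)` at `x`. -/
def koszul (X Y Z : Π x : M, TangentSpace 𝓘(ℝ, E) x) (x : M) : ℝ :=
  (1 / 2 : ℝ) *
    (mvfderiv 𝓘(ℝ, E) (fun y ↦ ⟪Y y, Z y⟫_ℝ) x (X x)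
      + mvfderiv 𝓘(ℝ, E) (fun y ↦ ⟪X y, Z y⟫_ℝ) x (Y x)
      - mvfderiv 𝓘(ℝ, E) (fun y ↦ ⟪X y, Y y⟫_ℝ) x (Z x)
      + ⟪VectorField.mlieBracket 𝓘(ℝ, E) X Y x, Z x⟫_ℝ
      - ⟪VectorField.mlieBracket 𝓘(ℝ, E) X Z x, Y x⟫_ℝ
      - ⟪VectorField.mlieBracket 𝓘(ℝ, E) Y Z x, X x⟫_ℝ)

variable [IsManifold 𝓘(ℝ, E) ∞ M]
  [IsContMDiffRiemannianBundle 𝓘(ℝ, E) ∞ E (fun x : M ↦ TangentSpace 𝓘(ℝ, E) x)]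

theorem mdifferentiableAt_inner {Y Z : Π x : M, TangentSpace 𝓘(ℝ, E) x} {x : M}
    (hY : MDiffAt (T% Y) x) (hZ : MDiffAt (T% Z) x) :
    MDiffAt (fun y ↦ ⟪Y y, Z y⟫_ℝ) x :=
  MDifferentiableAt.inner_bundle (F := E) (E := fun x : M ↦ TangentSpace 𝓘(ℝ, E) x)
    (b := id) hY hZ

theorem koszul_tensorial_left {Y Z : Π x : M, TangentSpace 𝓘(ℝ, E) x} {x : M}
    (hY : MDiffAt (T% Y) x) (hZ : MDiffAt (T% Z) x) :
    TensorialAt 𝓘(ℝ, E) E (fun X ↦ koszul X Y Z x) x where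
  smul {f X} hf hX := by
    have h1 : mvfderiv 𝓘(ℝ, E) (fun y ↦ ⟪(f • X) y, Z y⟫_ℝ) x (Y x)
        = f x * mvfderiv 𝓘(ℝ, E) (fun y ↦ ⟪X y, Z y⟫_ℝ) x (Y x)
          + ⟪X x, Z x⟫_ℝ * mvfderiv 𝓘(ℝ, E) f x (Y x) := by
      simp [mvfderiv_fun_mul hf (mdifferentiableAt_inner hX hZ), inner_smul_left]
    have h2 : mvfderiv 𝓘(ℝ, E) (fun y ↦ ⟪(f • X) y, Y y⟫_ℝ) x (Z x)
        = f x * mvfderiv 𝓘(ℝ, E) (fun y ↦ ⟪X y, Y y⟫_ℝ) x (Z x)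
          + ⟪X x, Y x⟫_ℝ * mvfderiv 𝓘(ℝ, E) f x (Z x) := by
      simp [mvfderiv_fun_mul hf (mdifferentiableAt_inner hX hY), inner_smul_left]
    simp only [koszul, h1, h2, VectorField.mlieBracket_smul_left hf hX]
    simp [inner_add_left, inner_smul_left, inner_smul_right]
    ring_nf
  add {X X'} hX hX' := by
    have h1 : mvfderiv 𝓘(ℝ, E) (fun y ↦ ⟪(X + X') y, Z y⟫_ℝ) x (Y x)
        = mvfderiv 𝓘(ℝ, E) (fun y ↦ ⟪X y, Z y⟫_ℝ) x (Y x)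
          + mvfderiv 𝓘(ℝ, E) (fun y ↦ ⟪X' y, Z y⟫_ℝ) x (Y x) := by
      simp [mvfderiv_fun_add (mdifferentiableAt_inner hX hZ) (mdifferentiableAt_inner hX' hZ), inner_add_left]
    have h2 : mvfderiv 𝓘(ℝ, E) (fun y ↦ ⟪(X + X') y, Y y⟫_ℝ) x (Z x)
        = mvfderiv 𝓘(ℝ, E) (fun y ↦ ⟪X y, Y y⟫_ℝ) x (Z x)
          + mvfderiv 𝓘(ℝ, E) (fun y ↦ ⟪X' y, Y y⟫_ℝ) x (Z x) := by
      simp [mvfderiv_fun_add (mdifferentiableAt_inner hX hY) (mdifferentiableAt_inner hX' hY), inner_add_left]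
    simp only [koszul, h1, h2, VectorField.mlieBracket_add_left hX hX']
    simp [inner_add_left, inner_add_right]
    ring

theorem koszul_add_middle {X Y Y' Z : Π x : M, TangentSpace 𝓘(ℝ, E) x} {x : M}
    (hX : MDiffAt (T% X) x) (hY : MDiffAt (T% Y) x) (hY' : MDiffAt (T% Y') x)
    (hZ : MDiffAt (T% Z) x) :
    koszul X (Y + Y') Z x = koszul X Y Z x + koszul X Y' Z x := by
  have h1 : mvfderiv 𝓘(ℝ, E) (fun y ↦ ⟪(Y + Y') y, Z y⟫_ℝ) x (X x)
      = mvfderiv 𝓘(ℝ, E) (fun y ↦ ⟪Y y, Z y⟫_ℝ) x (X x)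
        + mvfderiv 𝓘(ℝ, E) (fun y ↦ ⟪Y' y, Z y⟫_ℝ) x (X x) := by
    simp [mvfderiv_fun_add (mdifferentiableAt_inner hY hZ) (mdifferentiableAt_inner hY' hZ), inner_add_left]
  have h2 : mvfderiv 𝓘(ℝ, E) (fun y ↦ ⟪X y, (Y + Y') y⟫_ℝ) x (Z x)
      = mvfderiv 𝓘(ℝ, E) (fun y ↦ ⟪X y, Y y⟫_ℝ) x (Z x)
        + mvfderiv 𝓘(ℝ, E) (fun y ↦ ⟪X y, Y' y⟫_ℝ) x (Z x) := by
    simp [mvfderiv_fun_add (mdifferentiableAt_inner hX hY) (mdifferentiableAt_inner hX hY'), inner_add_right]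
  simp only [koszul, h1, h2, VectorField.mlieBracket_add_left hY hY',
    VectorField.mlieBracket_add_right hY hY']
  simp [inner_add_left, inner_add_right]
  ring

theorem koszul_smul_middle {X Y Z : Π x : M, TangentSpace 𝓘(ℝ, E) x} {f : M → ℝ} {x : M}
    (hX : MDiffAt (T% X) x) (hY : MDiffAt (T% Y) x) (hZ : MDiffAt (T% Z) x)
    (hf : MDiffAt f x) :
    koszul X (f • Y) Z x
      = f x * koszul X Y Z x + mvfderiv 𝓘(ℝ, E) f x (X x) * ⟪Y x, Z x⟫_ℝ := by
  have h1 : mvfderiv 𝓘(ℝ, E) (fun y ↦ ⟪(f • Y) y, Z y⟫_ℝ) x (X x)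
      = f x * mvfderiv 𝓘(ℝ, E) (fun y ↦ ⟪Y y, Z y⟫_ℝ) x (X x)
        + ⟪Y x, Z x⟫_ℝ * mvfderiv 𝓘(ℝ, E) f x (X x) := by
    simp [mvfderiv_fun_mul hf (mdifferentiableAt_inner hY hZ), inner_smul_left]
  have h2 : mvfderiv 𝓘(ℝ, E) (fun y ↦ ⟪X y, (f • Y) y⟫_ℝ) x (Z x)
      = f x * mvfderiv 𝓘(ℝ, E) (fun y ↦ ⟪X y, Y y⟫_ℝ) x (Z x)
        + ⟪X x, Y x⟫_ℝ * mvfderiv 𝓘(ℝ, E) f x (Z x) := by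
    simp [mvfderiv_fun_mul hf (mdifferentiableAt_inner hX hY), inner_smul_right]
  simp only [koszul, h1, h2, VectorField.mlieBracket_smul_left hf hY,
    VectorField.mlieBracket_smul_right hf hY]
  simp [inner_add_left, inner_smul_left, inner_smul_right]
  rw [real_inner_comm (Y x) (X x)]
  ring

theorem koszul_tensorial_right {X Y : Π x : M, TangentSpace 𝓘(ℝ, E) x} {x : M}
    (hX : MDiffAt (T% X) x) (hY : MDiffAt (T% Y) x) :
    TensorialAt 𝓘(ℝ, E) E (fun Z ↦ koszul X Y Z x) x where
  smul {f Z} hf hZ := by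
    have h1 : mvfderiv 𝓘(ℝ, E) (fun y ↦ ⟪Y y, (f • Z) y⟫_ℝ) x (X x)
        = f x * mvfderiv 𝓘(ℝ, E) (fun y ↦ ⟪Y y, Z y⟫_ℝ) x (X x)
          + ⟪Y x, Z x⟫_ℝ * mvfderiv 𝓘(ℝ, E) f x (X x) := by
      simp [mvfderiv_fun_mul hf (mdifferentiableAt_inner hY hZ), inner_smul_right]
    have h2 : mvfderiv 𝓘(ℝ, E) (fun y ↦ ⟪X y, (f • Z) y⟫_ℝ) x (Y x)
        = f x * mvfderiv 𝓘(ℝ, E) (fun y ↦ ⟪X y, Z y⟫_ℝ) x (Y x)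
          + ⟪X x, Z x⟫_ℝ * mvfderiv 𝓘(ℝ, E) f x (Y x) := by
      simp [mvfderiv_fun_mul hf (mdifferentiableAt_inner hX hZ), inner_smul_right]
    simp only [koszul, h1, h2, VectorField.mlieBracket_smul_right hf hZ]
    simp [inner_add_left, inner_smul_left, inner_smul_right]
    rw [real_inner_comm (Z x) (X x), real_inner_comm (Z x) (Y x)]
    ring
  add {Z Z'} hZ hZ' := by
    have h1 : mvfderiv 𝓘(ℝ, E) (fun y ↦ ⟪Y y, (Z + Z') y⟫_ℝ) x (X x)
        = mvfderiv 𝓘(ℝ, E) (fun y ↦ ⟪Y y, Z y⟫_ℝ) x (X x)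
          + mvfderiv 𝓘(ℝ, E) (fun y ↦ ⟪Y y, Z' y⟫_ℝ) x (X x) := by
      simp [mvfderiv_fun_add (mdifferentiableAt_inner hY hZ) (mdifferentiableAt_inner hY hZ'),
        inner_add_right]
    have h2 : mvfderiv 𝓘(ℝ, E) (fun y ↦ ⟪X y, (Z + Z') y⟫_ℝ) x (Y x)
        = mvfderiv 𝓘(ℝ, E) (fun y ↦ ⟪X y, Z y⟫_ℝ) x (Y x)
          + mvfderiv 𝓘(ℝ, E) (fun y ↦ ⟪X y, Z' y⟫_ℝ) x (Y x) := by
      simp [mvfderiv_fun_add (mdifferentiableAt_inner hX hZ) (mdifferentiableAt_inner hX hZ'),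
        inner_add_right]
    simp only [koszul, h1, h2, VectorField.mlieBracket_add_right hZ hZ']
    simp [inner_add_left, inner_add_right]
    ring

open Classical in
/-- The Levi-Civita covariant derivative, given by the Koszul formula: for `Y` differentiable at
`x` and `e` an orthonormal basis of `T_x M`, `∇_v Y = ∑ i, koszul (v, Y, e i) • e i`.
(The Koszul expression at `x` depends on its first and third arguments only through their values
at `x`.) At fields that are not differentiable at `x` the function takes the value `0`. -/
def leviCivitaFun (Y : Π x : M, TangentSpace 𝓘(ℝ, E) x) (x : M) :
    TangentSpace 𝓘(ℝ, E) x →L[ℝ] TangentSpace 𝓘(ℝ, E) x :=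
  if hY : MDiffAt (T% Y) x then
    ∑ i, (TensorialAt.mkHom (I := 𝓘(ℝ, E)) (F := E) (fun X ↦
      koszul X Y (extend E (stdOrthonormalBasis ℝ (TangentSpace 𝓘(ℝ, E) x) i)) x) x
        (koszul_tensorial_left hY (mdifferentiableAt_extend 𝓘(ℝ, E) E _))).smulRight
          (stdOrthonormalBasis ℝ (TangentSpace 𝓘(ℝ, E) x) i)
  else 0

/-- The Koszul formula. -/
theorem inner_leviCivitaFun {X Y Z : Π x : M, TangentSpace 𝓘(ℝ, E) x} {x : M}
    (hX : MDiffAt (T% X) x) (hY : MDiffAt (T% Y) x) (hZ : MDiffAt (T% Z) x) :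
    ⟪leviCivitaFun Y x (X x), Z x⟫_ℝ = koszul X Y Z x := by
  set b := stdOrthonormalBasis ℝ (TangentSpace 𝓘(ℝ, E) x) with hb
  have hT := koszul_tensorial_right hX hY
  have key : ∀ w : TangentSpace 𝓘(ℝ, E) x, TensorialAt.mkHom _ x hT w
      = koszul X Y (extend E w) x := fun w ↦ rfl
  have h2 : leviCivitaFun Y x (X x) = ∑ i, koszul X Y (extend E (b i)) x • b i := by
    simp only [leviCivitaFun, dif_pos hY]
    rw [_root_.sum_apply]
    refine Finset.sum_congr rfl fun i _ ↦ ?_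
    rw [ContinuousLinearMap.smulRight_apply, TensorialAt.mkHom_apply _ hX]
  rw [h2, ← TensorialAt.mkHom_apply hT hZ]
  conv_rhs => rw [← b.sum_repr' (Z x), map_sum]
  rw [sum_inner]
  refine Finset.sum_congr rfl fun i _ ↦ ?_
  rw [map_smul, key, real_inner_smul_left, smul_eq_mul, mul_comm]

variable (E M) in
/-- The Levi-Civita connection of a Riemannian manifold. Beware of Mathlib's argument order:
`leviCivita E M Y x v` is `(∇_v Y)(x)`. -/
def leviCivita : CovariantDerivative 𝓘(ℝ, E) E (fun x : M ↦ TangentSpace 𝓘(ℝ, E) x) where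
  toFun := leviCivitaFun
  isCovariantDerivativeOnUniv :=
    { add := by
        intro Y Y' x hY hY' _
        ext v
        refine ext_inner_right ℝ fun w ↦ ?_
        have hv := mdifferentiableAt_extend 𝓘(ℝ, E) E v
        have hw := mdifferentiableAt_extend 𝓘(ℝ, E) E w
        have := inner_leviCivitaFun hv (mdifferentiableAt_add_section hY hY') hw
        have h1 := inner_leviCivitaFun hv hY hw
        have h2 := inner_leviCivitaFun hv hY' hw
        rw [koszul_add_middle hv hY hY' hw, ← h1, ← h2] at this
        simpa [inner_add_left] using this
      leibniz := by
        intro Y f x hY hf _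
        ext v
        refine ext_inner_right ℝ fun w ↦ ?_
        have hv := mdifferentiableAt_extend 𝓘(ℝ, E) E v
        have hw := mdifferentiableAt_extend 𝓘(ℝ, E) E w
        have := inner_leviCivitaFun hv (hf.smul_section hY) hw
        have h1 := inner_leviCivitaFun hv hY hw
        rw [koszul_smul_middle hv hY hw hf, ← h1] at this
        simpa [inner_add_left, inner_smul_left] using this }

theorem leviCivita_torsion_free {X Y : Π x : M, TangentSpace 𝓘(ℝ, E) x} {x : M}
    (hX : MDiffAt (T% X) x) (hY : MDiffAt (T% Y) x) :
    leviCivita E M Y x (X x) - leviCivita E M X x (Y x)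
      = VectorField.mlieBracket 𝓘(ℝ, E) X Y x := by
  refine ext_inner_right ℝ fun w ↦ ?_
  have hw := mdifferentiableAt_extend 𝓘(ℝ, E) E w
  have h1 := inner_leviCivitaFun hX hY hw
  have h2 := inner_leviCivitaFun hY hX hw
  rw [extend_apply_self] at h1 h2
  rw [inner_sub_left]
  change ⟪leviCivitaFun Y x (X x), w⟫_ℝ - ⟪leviCivitaFun X x (Y x), w⟫_ℝ = _
  rw [h1, h2]
  simp only [koszul, extend_apply_self, VectorField.mlieBracket_swap_apply (V := Y) (W := X),
    inner_neg_left, real_inner_comm]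
  ring

theorem leviCivita_metric {X Y Z : Π x : M, TangentSpace 𝓘(ℝ, E) x} {x : M}
    (hX : MDiffAt (T% X) x) (hY : MDiffAt (T% Y) x) (hZ : MDiffAt (T% Z) x) :
    mvfderiv 𝓘(ℝ, E) (fun y ↦ ⟪Y y, Z y⟫_ℝ) x (X x)
      = ⟪leviCivita E M Y x (X x), Z x⟫_ℝ + ⟪Y x, leviCivita E M Z x (X x)⟫_ℝ := by
  have h1 := inner_leviCivitaFun hX hY hZ
  have h2 := inner_leviCivitaFun hX hZ hY
  rw [real_inner_comm _ (Y x)]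
  change _ = ⟪leviCivitaFun Y x (X x), Z x⟫_ℝ + ⟪leviCivitaFun Z x (X x), Y x⟫_ℝ
  rw [h1, h2]
  simp only [koszul, VectorField.mlieBracket_swap_apply (V := Z) (W := Y),
    inner_neg_left, real_inner_comm]
  ring

end LeviCivita

section Maps

variable {E : Type*} [NormedAddCommGroup E] [NormedSpace ℝ E] [FiniteDimensional ℝ E]
  {M : Type*} [TopologicalSpace M] [ChartedSpace E M]
  [RiemannianBundle (fun x : M ↦ TangentSpace 𝓘(ℝ, E) x)]
  {F : Type*} [NormedAddCommGroup F] [NormedSpace ℝ F] [FiniteDimensional ℝ F]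
  {N : Type*} [TopologicalSpace N] [ChartedSpace F N]
  [RiemannianBundle (fun y : N ↦ TangentSpace 𝓘(ℝ, F) y)]

/-- A map is a submersion when its differential is surjective at every point. -/
def IsSubmersionMap (φ : M → N) : Prop :=
  ∀ x, Function.Surjective (mfderiv 𝓘(ℝ, E) 𝓘(ℝ, F) φ x)

/-- The adjoint `dφ_x^* : T_{φ x} N → T_x M` of the differential of `φ`. -/
def adjointDifferential (φ : M → N) (x : M) :
    TangentSpace 𝓘(ℝ, F) (φ x) →ₗ[ℝ] TangentSpace 𝓘(ℝ, E) x :=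
  LinearMap.adjoint
    (mfderiv 𝓘(ℝ, E) 𝓘(ℝ, F) φ x : TangentSpace 𝓘(ℝ, E) x →ₗ[ℝ] TangentSpace 𝓘(ℝ, F) (φ x))

/-- The horizontal space at `x`: the orthogonal complement of the kernel of `dφ_x`. -/
def horizontalSpace (φ : M → N) (x : M) : Submodule ℝ (TangentSpace 𝓘(ℝ, E) x) :=
  (LinearMap.ker (mfderiv 𝓘(ℝ, E) 𝓘(ℝ, F) φ x :
    TangentSpace 𝓘(ℝ, E) x →ₗ[ℝ] TangentSpace 𝓘(ℝ, F) (φ x)))ᗮ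

variable [IsManifold 𝓘(ℝ, E) ∞ M]
  [IsContMDiffRiemannianBundle 𝓘(ℝ, E) ∞ E (fun x : M ↦ TangentSpace 𝓘(ℝ, E) x)]
  [IsManifold 𝓘(ℝ, F) ∞ N]
  [IsContMDiffRiemannianBundle 𝓘(ℝ, F) ∞ F (fun y : N ↦ TangentSpace 𝓘(ℝ, F) y)]

/-- The covariant derivative `(∇^φ_v s)(x)` of a section `s` of `φ⁻¹TN`, for the connection induced
by the Levi-Civita connection of `N`. With `∂_α` the coordinate fields of the preferred chart of
`N` at `φ x` and `s = ∑ s^α (∂_α ∘ φ)`, this is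
`∑ v(s^α) ∂_α + ∇^N_{dφ v} (∑ s^α(x) ∂_α)`; `extend F w` is the field with constant coordinates
and value `w`. -/
def pullbackCov (φ : M → N) (s : Π x : M, TangentSpace 𝓘(ℝ, F) (φ x)) (x : M)
    (v : TangentSpace 𝓘(ℝ, E) x) : TangentSpace 𝓘(ℝ, F) (φ x) :=
  (trivializationAt F (fun y : N ↦ TangentSpace 𝓘(ℝ, F) y) (φ x)).symm (φ x)
      (mvfderiv 𝓘(ℝ, E) (fun z : M ↦
        (trivializationAt F (fun y : N ↦ TangentSpace 𝓘(ℝ, F) y) (φ x) ⟨φ z, s z⟩).2) x v)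
    + leviCivita F N (extend F (s x)) (φ x) (mfderiv 𝓘(ℝ, E) 𝓘(ℝ, F) φ x v)

/-- The second fundamental form of a map,
`(∇dφ)(v, w) = ∇^φ_v (dφ W) - dφ (∇^M_v W)` where `W` is a field extending `w`. -/
def mapSecondFundamentalForm (φ : M → N) (x : M) (v w : TangentSpace 𝓘(ℝ, E) x) :
    TangentSpace 𝓘(ℝ, F) (φ x) :=
  pullbackCov (E := E) (F := F) φ (fun z ↦ mfderiv 𝓘(ℝ, E) 𝓘(ℝ, F) φ z (extend E w z)) x v
    - mfderiv 𝓘(ℝ, E) 𝓘(ℝ, F) φ x (leviCivita E M (extend E w) x v)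

/-- The tension field `τ(φ) = trace ∇dφ`. -/
def tensionField (φ : M → N) (x : M) : TangentSpace 𝓘(ℝ, F) (φ x) :=
  ∑ i, mapSecondFundamentalForm (E := E) (F := F) φ x
    (stdOrthonormalBasis ℝ (TangentSpace 𝓘(ℝ, E) x) i)
    (stdOrthonormalBasis ℝ (TangentSpace 𝓘(ℝ, E) x) i)

/-- `φ` is `V`-harmonic: `τ(φ) + dφ(V) = 0`. -/
def IsVHarmonic (V : Π x : M, TangentSpace 𝓘(ℝ, E) x) (φ : M → N) : Prop :=
  ∀ x, tensionField (E := E) (F := F) φ x + mfderiv 𝓘(ℝ, E) 𝓘(ℝ, F) φ x (V x) = 0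

end Maps

section Submanifolds

/-- `K` is an embedded `C^r` submanifold over `𝕜` of dimension `k`: around each of its points there
is a chart of the `C^r` structure in which `K` is a `k`-dimensional linear subspace. For `𝕜 = ℝ`
and `r = ∞` these are the smooth submanifolds, for `𝕜 = ℂ` and `r = ω` the complex submanifolds
(and then `k` is the complex dimension). -/
def IsEmbeddedSubmanifold (𝕜 : Type*) [NontriviallyNormedField 𝕜] {E : Type*}
    [NormedAddCommGroup E] [NormedSpace 𝕜 E] {M : Type*} [TopologicalSpace M] [ChartedSpace E M]
    (r : ℕ∞ω) (K : Set M) (k : ℕ) : Prop :=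
  ∀ x ∈ K, ∃ e ∈ IsManifold.maximalAtlas 𝓘(𝕜, E) r M, x ∈ e.source ∧
    ∃ S : Submodule 𝕜 E, finrank 𝕜 S = k ∧ ∀ y ∈ e.source, y ∈ K ↔ e y ∈ S

variable {E : Type*} [NormedAddCommGroup E] [NormedSpace ℝ E]
  {M : Type*} [TopologicalSpace M] [ChartedSpace E M]

/-- The tangent space `T_x K`, as a subspace of `T_x M`: the vectors `v` with `df_x(v) = 0` for all
smooth functions `f` near `x` that vanish on `K`. -/
def tangentSubspace (K : Set M) (x : M) : Submodule ℝ (TangentSpace 𝓘(ℝ, E) x) where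
  carrier := {v | ∀ f : M → ℝ, (∀ᶠ y in 𝓝 x, ContMDiffAt 𝓘(ℝ, E) 𝓘(ℝ, ℝ) ∞ f y) →
    (∀ᶠ y in 𝓝[K] x, f y = 0) → mvfderiv 𝓘(ℝ, E) f x v = 0}
  zero_mem' := fun f _ _ ↦ map_zero _
  add_mem' := fun hv hw f hf h0 ↦ by rw [map_add, hv f hf h0, hw f hf h0, add_zero]
  smul_mem' := fun c v hv f hf h0 ↦ by rw [map_smul, hv f hf h0, smul_zero]

/-- A vector field is smooth near `x`. -/
def IsSmoothNear [IsManifold 𝓘(ℝ, E) ∞ M] (W : Π y : M, TangentSpace 𝓘(ℝ, E) y) (x : M) : Prop :=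
  ∀ᶠ y in 𝓝 x, ContMDiffAt 𝓘(ℝ, E) (𝓘(ℝ, E).prod 𝓘(ℝ, E)) ∞
    (fun z ↦ (⟨z, W z⟩ : TangentBundle 𝓘(ℝ, E) M)) y

/-- `W` is a smooth vector field on `M` near `x`, tangent to `K` along `K`, with value `w`
at `x`. -/
def IsTangentExtension [IsManifold 𝓘(ℝ, E) ∞ M] (K : Set M) (x : M)
    (w : TangentSpace 𝓘(ℝ, E) x) (W : Π y : M, TangentSpace 𝓘(ℝ, E) y) : Prop :=
  IsSmoothNear W x ∧ (∀ᶠ y in 𝓝[K] x, W y ∈ tangentSubspace K y) ∧ W x = w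

variable [FiniteDimensional ℝ E]
  [RiemannianBundle (fun x : M ↦ TangentSpace 𝓘(ℝ, E) x)] [IsManifold 𝓘(ℝ, E) ∞ M]
  [IsContMDiffRiemannianBundle 𝓘(ℝ, E) ∞ E (fun x : M ↦ TangentSpace 𝓘(ℝ, E) x)]

open Classical in
/-- The second fundamental form `A(v, w)` of `K` at `x` for `v`, `w` in `T_x K`: the component
normal to `K` of `∇^M_v W`, where `W` is a smooth local field tangent to `K` that extends `w`.
(On a submanifold such a `W` exists and the normal component does not depend on it.) -/
def secondFundamentalForm (K : Set M) (x : M) (v w : TangentSpace 𝓘(ℝ, E) x) :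
    TangentSpace 𝓘(ℝ, E) x :=
  if h : ∃ W, IsTangentExtension K x w W then
    (tangentSubspace (E := E) K x)ᗮ.starProjection (leviCivita E M h.choose x v)
  else 0

/-- The trace of the second fundamental form of `K` at `x`, over an orthonormal basis of `T_x K`. -/
def traceSecondFundamentalForm (K : Set M) (x : M) : TangentSpace 𝓘(ℝ, E) x :=
  ∑ i, secondFundamentalForm K x
    (stdOrthonormalBasis ℝ (tangentSubspace (E := E) K x) i : TangentSpace 𝓘(ℝ, E) x)
    (stdOrthonormalBasis ℝ (tangentSubspace (E := E) K x) i : TangentSpace 𝓘(ℝ, E) x)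

/-- `K` is a `V`-minimal submanifold of dimension `k`: a smooth submanifold such that
`trace A - V` is tangent to `K` at every point of `K`. -/
def IsVMinimalSubmanifold (V : Π x : M, TangentSpace 𝓘(ℝ, E) x) (K : Set M) (k : ℕ) : Prop :=
  IsEmbeddedSubmanifold ℝ (E := E) ∞ K k ∧
    ∀ x ∈ K, traceSecondFundamentalForm (E := E) K x - V x ∈ tangentSubspace K x

end Submanifolds

section Complex

variable {F : Type*} [NormedAddCommGroup F] [NormedSpace ℂ F]
  {N : Type*} [TopologicalSpace N] [ChartedSpace F N]

/-- The complex structure `J` of a complex manifold at `y`, acting on the real tangent space. In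
the preferred chart at `y` it is multiplication by `i`; since the changes of charts of a complex
manifold are holomorphic, it is multiplication by `i` in every chart. -/
def complexStructure (y : N) : TangentSpace 𝓘(ℝ, F) y →ₗ[ℝ] TangentSpace 𝓘(ℝ, F) y :=
  (show F →ₗ[ℝ] F from (LinearMap.lsmul ℂ F Complex.I).restrictScalars ℝ)

variable [FiniteDimensional ℂ F]
  [RiemannianBundle (fun y : N ↦ TangentSpace 𝓘(ℝ, F) y)] [IsManifold 𝓘(ℝ, F) ∞ N]
  [IsContMDiffRiemannianBundle 𝓘(ℝ, F) ∞ F (fun y : N ↦ TangentSpace 𝓘(ℝ, F) y)]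

variable (F N) in
/-- The Riemannian metric of the complex manifold `N` is Kähler: it is Hermitian and `∇J = 0`. -/
def IsKahler : Prop :=
  (∀ (y : N) (u v : TangentSpace 𝓘(ℝ, F) y),
    ⟪complexStructure y u, complexStructure y v⟫_ℝ = ⟪u, v⟫_ℝ) ∧
  ∀ (y : N) (Y : Π z : N, TangentSpace 𝓘(ℝ, F) z), IsSmoothNear Y y →
    ∀ v : TangentSpace 𝓘(ℝ, F) y,
      leviCivita F N (fun z ↦ complexStructure z (Y z)) y v
        = complexStructure y (leviCivita F N Y y v)

variable {E : Type*} [NormedAddCommGroup E] [NormedSpace ℝ E] [FiniteDimensional ℝ E]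
  {M : Type*} [TopologicalSpace M] [ChartedSpace E M]
  [RiemannianBundle (fun x : M ↦ TangentSpace 𝓘(ℝ, E) x)] [IsManifold 𝓘(ℝ, E) ∞ M]
  [IsContMDiffRiemannianBundle 𝓘(ℝ, E) ∞ E (fun x : M ↦ TangentSpace 𝓘(ℝ, E) x)]

/-- Pseudo-horizontal weak conformality at `x`: `[dφ_x ∘ dφ_x^*, J] = 0`. -/
def IsPHWCAt (φ : M → N) (x : M) : Prop :=
  ∀ u : TangentSpace 𝓘(ℝ, F) (φ x),
    mfderiv 𝓘(ℝ, E) 𝓘(ℝ, F) φ x (adjointDifferential (E := E) (F := F) φ x (complexStructure (φ x) u))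
      = complexStructure (φ x) (mfderiv 𝓘(ℝ, E) 𝓘(ℝ, F) φ x (adjointDifferential (E := E) (F := F) φ x u))

/-- Pseudo-horizontal homothety at `x`: `φ` is PHWC at `x` and
`dφ_x(∇_v dφ^*(JY)) = J dφ_x(∇_v dφ^*(Y))` for all horizontal `v` at `x` and all smooth vector
fields `Y` defined near `φ x`. -/
def IsPHHAt (φ : M → N) (x : M) : Prop :=
  IsPHWCAt (E := E) (F := F) φ x ∧
  ∀ v ∈ horizontalSpace (E := E) (F := F) φ x, ∀ Y : Π y : N, TangentSpace 𝓘(ℝ, F) y, IsSmoothNear Y (φ x) →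
    mfderiv 𝓘(ℝ, E) 𝓘(ℝ, F) φ x
        (leviCivita E M
          (fun z ↦ adjointDifferential (E := E) (F := F) φ z (complexStructure (φ z) (Y (φ z)))) x v)
      = complexStructure (φ x) (mfderiv 𝓘(ℝ, E) 𝓘(ℝ, F) φ x
          (leviCivita E M (fun z ↦ adjointDifferential (E := E) (F := F) φ z (Y (φ z))) x v))

/-- A pseudo-horizontally homothetic map. -/
def IsPHH (φ : M → N) : Prop := ∀ x, IsPHHAt (E := E) (F := F) φ x

end Complex

end VMinimal

end

/-! Near a point of `K`, write `P` as the zero set of a holomorphic vector-valued map `ψ` and put `f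
= ψ ∘ φ`. Then `K` is locally the zero set of `f`, and `T_x K` is the kernel of `df_x`. So the claim
is `df(trace A) = df(V)`.

Differentiating `df(W) = 0` along `K` for a field `W` tangent to `K` gives `df(A(v, w)) = -Hess f(v,
w)`, hence `df(trace A) = -trace_{TK} Hess f` (`mvfderiv_secondFundamentalForm`). On the other side,
`V`-harmonicity gives `df(V) = dψ(dφ(V)) = -dψ(τ(φ))`. What remains is `dψ(τ(φ)) = trace_{TK} Hess
f` (`mvfderiv_tensionField`).

By the composition formula (`mvfderiv_mapSecondFundamentalForm`), `dψ(τ(φ))` is the full trace of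
`Hess f` minus the trace of `Hess ψ(dφ, dφ)`. Two traces have to vanish: that of `Hess ψ(dφ, dφ)`
over `T_x M`, and that of `Hess f` over the normal space of `K`, which is horizontal.

Both vanish for the same reason (`traceOn_orthogonal_comap_eq_zero`). The adjoint `dφ^*` carries `J`
to a complex structure on the horizontal space, which is an isometry because `dφ ∘ dφ^*` commutes
with `J`. A symmetric form `b` that is complex linear for it satisfies `b(Lu, Lu) = i² b(u, u) =
-b(u, u)`, so its trace equals its own negative. For `Hess ψ` complex linearity comes from `∇J = 0`
(`hess_complexStructure`); for `Hess f` in horizontal directions it is what the PHH condition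
provides (`hess_comp_adjointDifferential`). -/

set_option linter.unusedSectionVars false

noncomputable section

namespace VMinimal

/-! ### Traces of vector-valued bilinear maps over subspaces -/

section Trace

variable {T : Type*} [NormedAddCommGroup T] [InnerProductSpace ℝ T]
  {G : Type*} [AddCommGroup G] [Module ℝ G]

/-- The trace of a bilinear map can be computed with any Parseval family. -/
theorem sum_bilin_eq_of_parseval (b : T →ₗ[ℝ] T →ₗ[ℝ] G) {ι κ : Type*} [Fintype ι] [Fintype κ]
    (v : ι → T) (e : OrthonormalBasis κ ℝ T)
    (hv : ∀ a c, ∑ i, ⟪v i, a⟫_ℝ * ⟪v i, c⟫_ℝ = ⟪a, c⟫_ℝ) :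
    ∑ i, b (v i) (v i) = ∑ j, b (e j) (e j) := by
  classical
  have h1 : ∀ i, b (v i) (v i)
      = ∑ j, ∑ k, (⟪v i, e j⟫_ℝ * ⟪v i, e k⟫_ℝ) • b (e j) (e k) := by
    intro i
    conv_lhs => rw [← e.sum_repr' (v i)]
    simp only [map_sum, map_smul, LinearMap.sum_apply, LinearMap.smul_apply, Finset.smul_sum,
      smul_smul]
    rw [Finset.sum_comm]
    refine Finset.sum_congr rfl fun j _ ↦ Finset.sum_congr rfl fun k _ ↦ ?_
    rw [real_inner_comm (v i) (e j), real_inner_comm (v i) (e k), mul_comm]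
  simp only [h1]
  rw [Finset.sum_comm]
  refine Finset.sum_congr rfl fun j _ ↦ ?_
  rw [Finset.sum_comm]
  simp only [← Finset.sum_smul, hv]
  rw [Finset.sum_eq_single j]
  · simp
  · intro k _ hk
    rw [e.orthonormal.2 hk.symm, zero_smul]
  · simp

theorem sum_bilin_orthonormalBasis_congr (b : T →ₗ[ℝ] T →ₗ[ℝ] G) {ι κ : Type*} [Fintype ι]
    [Fintype κ] (v : OrthonormalBasis ι ℝ T) (e : OrthonormalBasis κ ℝ T) :
    ∑ i, b (v i) (v i) = ∑ j, b (e j) (e j) :=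
  sum_bilin_eq_of_parseval b v e fun a c ↦ by
    rw [← v.sum_inner_mul_inner a c]
    exact Finset.sum_congr rfl fun i _ ↦ by rw [real_inner_comm]

variable [FiniteDimensional ℝ T]

/-- The trace of a bilinear map over the subspace `S`. -/
def traceOn (b : T →ₗ[ℝ] T →ₗ[ℝ] G) (S : Submodule ℝ T) : G :=
  ∑ i, b (stdOrthonormalBasis ℝ S i : T) (stdOrthonormalBasis ℝ S i : T)

/-- The bases of `S` and `Sᗮ` together form a Parseval family, because `a` is the sum of its two
projections. This avoids assembling them into an orthonormal basis of `T`. -/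
theorem sum_bilin_eq_traceOn_add_traceOn_orthogonal (b : T →ₗ[ℝ] T →ₗ[ℝ] G) {κ : Type*}
    [Fintype κ] (e : OrthonormalBasis κ ℝ T) (S : Submodule ℝ T) :
    ∑ j, b (e j) (e j) = traceOn b S + traceOn b Sᗮ := by
  rw [traceOn, traceOn, ← sum_bilin_eq_of_parseval b (Sum.elim
    (fun i ↦ (stdOrthonormalBasis ℝ S i : T)) (fun i ↦ (stdOrthonormalBasis ℝ Sᗮ i : T))) e]
  · rw [Fintype.sum_sum_type]
    rfl
  · intro a c
    have key : ∀ U : Submodule ℝ T, ∑ i, ⟪(stdOrthonormalBasis ℝ U i : T), a⟫_ℝ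
        * ⟪(stdOrthonormalBasis ℝ U i : T), c⟫_ℝ = ⟪U.starProjection a, c⟫_ℝ := by
      intro U
      have h := (stdOrthonormalBasis ℝ U).sum_inner_mul_inner (U.orthogonalProjectionOnto a)
        (U.orthogonalProjectionOnto c)
      rw [Submodule.starProjection_apply, ← Submodule.inner_orthogonalProjectionOnto_eq_of_mem_left,
        ← h]
      refine Finset.sum_congr rfl fun i _ ↦ ?_
      rw [real_inner_comm, Submodule.inner_orthogonalProjectionOnto_eq_of_mem_right,
        Submodule.inner_orthogonalProjectionOnto_eq_of_mem_left, real_inner_comm]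
    rw [Fintype.sum_sum_type]
    simp only [Sum.elim_inl, Sum.elim_inr]
    rw [key, key, ← inner_add_left, Submodule.starProjection_add_starProjection_orthogonal]

/-- A bilinear map that changes its sign under an isometry of `S` has no trace over `S`. -/
theorem traceOn_eq_zero (b : T →ₗ[ℝ] T →ₗ[ℝ] G) (S : Submodule ℝ T) (L : T →ₗ[ℝ] T)
    (hS : ∀ u ∈ S, L u ∈ S) (hL : ∀ u ∈ S, ‖L u‖ = ‖u‖) (hb : ∀ u ∈ S, b (L u) (L u) = -b u u) :
    traceOn b S = 0 := by
  -- An isometry of the finite-dimensional `S` into itself is onto, so it maps an orthonormal basis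
  -- to another one; the trace over the new basis is minus the trace over the old one.
  let L₁ : S →ₗᵢ[ℝ] S := ⟨L.restrict hS, fun u ↦ hL u u.2⟩
  let e := stdOrthonormalBasis ℝ S
  let e' := e.map (L₁.toLinearIsometryEquiv rfl)
  have h := sum_bilin_orthonormalBasis_congr (b.compl₁₂ S.subtype S.subtype) e' e
  have h1 : ∑ i, (b.compl₁₂ S.subtype S.subtype) (e' i) (e' i)
      = -∑ i, (b.compl₁₂ S.subtype S.subtype) (e i) (e i) := by
    rw [← Finset.sum_neg_distrib]
    exact Finset.sum_congr rfl fun i _ ↦ hb _ (e i).2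
  rw [h] at h1
  have h2 : (2 : ℝ) • traceOn b S = 0 := by
    rw [two_smul]
    exact eq_neg_iff_add_eq_zero.1 h1
  exact (smul_eq_zero.1 h2).resolve_left two_ne_zero

theorem traceOn_eq_zero_of_forall (b : T →ₗ[ℝ] T →ₗ[ℝ] G) (S : Submodule ℝ T)
    (hb : ∀ u ∈ S, b u u = 0) : traceOn b S = 0 :=
  Finset.sum_eq_zero fun i _ ↦ hb _ (stdOrthonormalBasis ℝ S i).2

end Trace

/-! ### Coordinate vector fields of a chart -/

section ChartField

variable {E : Type*} [NormedAddCommGroup E] [NormedSpace ℝ E] [FiniteDimensional ℝ E]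
  {M : Type*} [TopologicalSpace M] [ChartedSpace E M] [IsManifold 𝓘(ℝ, E) ∞ M]
  {G : Type*} [NormedAddCommGroup G] [NormedSpace ℝ G]

/-- The constant vector field on a vector space. -/
def constField (b : E) : Π x : E, TangentSpace 𝓘(ℝ, E) x := fun _ ↦ b

omit [FiniteDimensional ℝ E] in
theorem contMDiffAt_constField (b x : E) :
    ContMDiffAt 𝓘(ℝ, E) (𝓘(ℝ, E).prod 𝓘(ℝ, E)) ∞
      (fun z ↦ (⟨z, constField b z⟩ : TangentBundle 𝓘(ℝ, E) E)) x :=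
  contMDiffAt_vectorSpace_iff_contDiffAt.2 contDiffAt_const

/-- The vector field with constant coordinates `b` in the chart `e`. -/
def chartField (e : OpenPartialHomeomorph M E) (b : E) : Π x : M, TangentSpace 𝓘(ℝ, E) x :=
  VectorField.mpullback 𝓘(ℝ, E) 𝓘(ℝ, E) e (constField b)

theorem mdifferentiable_of_mem_maximalAtlas {e : OpenPartialHomeomorph M E}
    (he : e ∈ IsManifold.maximalAtlas 𝓘(ℝ, E) ∞ M) : e.MDifferentiable 𝓘(ℝ, E) 𝓘(ℝ, E) :=
  ⟨(contMDiffOn_of_mem_maximalAtlas he).mdifferentiableOn (by simp),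
    (contMDiffOn_symm_of_mem_maximalAtlas he).mdifferentiableOn (by simp)⟩

variable {e : OpenPartialHomeomorph M E} (he : e ∈ IsManifold.maximalAtlas 𝓘(ℝ, E) ∞ M)
  {x : M} (hx : x ∈ e.source) (b : E)

include he hx

theorem isInvertible_mfderiv_of_mem_maximalAtlas :
    (mfderiv 𝓘(ℝ, E) 𝓘(ℝ, E) e x).IsInvertible :=
  ⟨(mdifferentiable_of_mem_maximalAtlas he).mfderiv hx, rfl⟩

theorem contMDiffAt_chartField :
    ContMDiffAt 𝓘(ℝ, E) (𝓘(ℝ, E).prod 𝓘(ℝ, E)) ∞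
      (fun z ↦ (⟨z, chartField e b z⟩ : TangentBundle 𝓘(ℝ, E) M)) x :=
  ContMDiffAt.mpullback_vectorField_preimage (n := ∞)
    (contMDiffAt_constField b _)
    (contMDiffAt_of_mem_maximalAtlas he hx) (isInvertible_mfderiv_of_mem_maximalAtlas he hx)
    (by simp)

theorem mdifferentiableAt_chartField : MDiffAt (T% (chartField e b)) x :=
  (contMDiffAt_chartField he hx b).mdifferentiableAt (by simp)

theorem isSmoothNear_chartField : IsSmoothNear (chartField e b) x :=
  (e.open_source.eventually_mem hx).mono fun _ hy ↦ contMDiffAt_chartField he hy b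

theorem mfderiv_chartField : mfderiv 𝓘(ℝ, E) 𝓘(ℝ, E) e x (chartField e b x) = b := by
  change ((mfderiv 𝓘(ℝ, E) 𝓘(ℝ, E) e x) ∘L (mfderiv 𝓘(ℝ, E) 𝓘(ℝ, E) e x).inverse)
    (constField b (e x)) = b
  rw [(isInvertible_mfderiv_of_mem_maximalAtlas he hx).self_comp_inverse]
  rfl

theorem chartField_mfderiv (v : TangentSpace 𝓘(ℝ, E) x) :
    chartField e (mfderiv 𝓘(ℝ, E) 𝓘(ℝ, E) e x v) x = v := by
  refine ((mdifferentiable_of_mem_maximalAtlas he).mfderiv_injective hx) ?_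
  exact mfderiv_chartField he hx _

theorem mvfderiv_eq_fderiv {f : M → G} (hf : MDiffAt f x) (v : TangentSpace 𝓘(ℝ, E) x) :
    mvfderiv 𝓘(ℝ, E) f x v = fderiv ℝ (f ∘ e.symm) (e x) (mfderiv 𝓘(ℝ, E) 𝓘(ℝ, E) e x v) := by
  have hd := mdifferentiable_of_mem_maximalAtlas he
  have h1 : f =ᶠ[𝓝 x] (f ∘ e.symm) ∘ e :=
    (e.open_source.eventually_mem hx).mono fun y hy ↦ by simp [e.left_inv hy]
  have hf' : MDifferentiableAt 𝓘(ℝ, E) 𝓘(ℝ, G) (f ∘ e.symm) (e x) := by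
    refine MDifferentiableAt.comp (I' := 𝓘(ℝ, E)) _ ?_ (hd.mdifferentiableAt_symm (e.map_source hx))
    rwa [e.left_inv hx]
  have h2 : mfderiv 𝓘(ℝ, E) 𝓘(ℝ, G) f x = mfderiv 𝓘(ℝ, E) 𝓘(ℝ, G) ((f ∘ e.symm) ∘ e) x :=
    h1.mfderiv_eq
  rw [mfderiv_comp x hf' (hd.mdifferentiableAt hx), mfderiv_eq_fderiv] at h2
  exact congrArg (fun L : E →L[ℝ] G ↦ L v) h2

theorem mvfderiv_chartField {f : M → G} (hf : MDiffAt f x) :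
    mvfderiv 𝓘(ℝ, E) f x (chartField e b x) = fderiv ℝ (f ∘ e.symm) (e x) b := by
  rw [mvfderiv_eq_fderiv he hx hf, mfderiv_chartField he hx]

/-- The bracket commutes with pullback by the chart, and constant fields commute. With vanishing
torsion this makes the connection symmetric on coordinate fields. -/
theorem mlieBracket_chartField (b' : E) :
    VectorField.mlieBracket 𝓘(ℝ, E) (chartField e b) (chartField e b') x = 0 := by
  have h0 : ∀ c : E, MDiffAt (T% (constField c)) (e x) := fun c ↦
    (contMDiffAt_constField c _).mdifferentiableAt (by simp)
  have : IsManifold 𝓘(ℝ, E) (minSmoothness ℝ 2) M :=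
    .of_le (n := ∞) (by simpa using ENat.LEInfty.out)
  have h := VectorField.mpullback_mlieBracket (h0 b) (h0 b')
    (contMDiffAt_of_mem_maximalAtlas he hx) (n := ∞) (by simpa using ENat.LEInfty.out)
  rw [chartField, chartField, ← h, VectorField.mpullback_apply]
  have : VectorField.mlieBracket 𝓘(ℝ, E) (constField b) (constField b') (e x) = 0 := by
    rw [← VectorField.mlieBracketWithin_univ, VectorField.mlieBracketWithin_eq_lieBracketWithin]
    change fderivWithin ℝ (fun _ : E ↦ b') Set.univ (e x) b
      - fderivWithin ℝ (fun _ : E ↦ b) Set.univ (e x) b' = 0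
    simp
  rw [this, map_zero]

end ChartField

/-! ### The Hessian of a vector-valued function -/

section Hessian

variable {E : Type*} [NormedAddCommGroup E] [NormedSpace ℝ E] [FiniteDimensional ℝ E]
  {M : Type*} [TopologicalSpace M] [ChartedSpace E M] [IsManifold 𝓘(ℝ, E) ∞ M]
  {G : Type*} [NormedAddCommGroup G] [NormedSpace ℝ G]

theorem mdifferentiableAt_mvfderiv_apply {f : M → G} {x : M}
    (hf : ContMDiffAt 𝓘(ℝ, E) 𝓘(ℝ, G) ∞ f x) {W : Π x : M, TangentSpace 𝓘(ℝ, E) x}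
    (hW : MDiffAt (T% W) x) : MDiffAt (fun y ↦ mvfderiv 𝓘(ℝ, E) f y (W y)) x := by
  have h1 := (hf.mfderiv_const (m := ∞) (by simp)).mdifferentiableAt (by simp)
  have h2 := MDifferentiableAt.clm_apply_of_inCoordinates (b₂ := f) h1 hW
    (hf.mdifferentiableAt (by simp))
  exact ((contMDiff_snd_tangentBundle_modelSpace (n := 1) G 𝓘(ℝ, G)).mdifferentiableAt
    (by simp)).comp x h2

variable [RiemannianBundle (fun x : M ↦ TangentSpace 𝓘(ℝ, E) x)]
  [IsContMDiffRiemannianBundle 𝓘(ℝ, E) ∞ E (fun x : M ↦ TangentSpace 𝓘(ℝ, E) x)]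

/-- The Hessian `(∇df)(v, W) = v(df W) - df(∇_v W)` of a vector-valued function. -/
def hessAlong (f : M → G) (x : M) (v : TangentSpace 𝓘(ℝ, E) x)
    (W : Π x : M, TangentSpace 𝓘(ℝ, E) x) : G :=
  mvfderiv 𝓘(ℝ, E) (fun y ↦ mvfderiv 𝓘(ℝ, E) f y (W y)) x v
    - mvfderiv 𝓘(ℝ, E) f x (leviCivita E M W x v)

/-- Replacing `W` by `a • W` adds the same Leibniz term `v(a) df(W)` to `v(df W)` and to `df(∇_v
W)`, and the two cancel. -/
theorem hessAlong_tensorial {f : M → G} {x : M} (hf : ContMDiffAt 𝓘(ℝ, E) 𝓘(ℝ, G) ∞ f x)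
    (v : TangentSpace 𝓘(ℝ, E) x) : TensorialAt 𝓘(ℝ, E) E (fun W ↦ hessAlong f x v W) x where
  smul {a W} ha hW := by
    have h1 : mvfderiv 𝓘(ℝ, E) (fun y ↦ mvfderiv 𝓘(ℝ, E) f y ((a • W) y)) x
        = mvfderiv 𝓘(ℝ, E) (a • fun y ↦ mvfderiv 𝓘(ℝ, E) f y (W y)) x := by
      congr 1
      ext y
      simp
    rw [hessAlong, h1, mvfderiv_smul ha (mdifferentiableAt_mvfderiv_apply hf hW),
      (leviCivita E M).isCovariantDerivativeOnUniv.leibniz hW ha, hessAlong]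
    simp [smul_sub]
  add {W W'} hW hW' := by
    have h1 : mvfderiv 𝓘(ℝ, E) (fun y ↦ mvfderiv 𝓘(ℝ, E) f y ((W + W') y)) x
        = mvfderiv 𝓘(ℝ, E) ((fun y ↦ mvfderiv 𝓘(ℝ, E) f y (W y))
          + fun y ↦ mvfderiv 𝓘(ℝ, E) f y (W' y)) x := by
      congr 1
      ext y
      simp
    rw [hessAlong, h1, mvfderiv_add (mdifferentiableAt_mvfderiv_apply hf hW)
      (mdifferentiableAt_mvfderiv_apply hf hW'),
      (leviCivita E M).isCovariantDerivativeOnUniv.add hW hW', hessAlong, hessAlong]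
    simp
    abel

/-- The Hessian of a function at a point where it is smooth, as a bilinear map. -/
def hess {f : M → G} {x : M} (hf : ContMDiffAt 𝓘(ℝ, E) 𝓘(ℝ, G) ∞ f x) :
    TangentSpace 𝓘(ℝ, E) x →ₗ[ℝ] TangentSpace 𝓘(ℝ, E) x →ₗ[ℝ] G where
  toFun v := (TensorialAt.mkHom (fun W ↦ hessAlong f x v W) x (hessAlong_tensorial hf v) :
    TangentSpace 𝓘(ℝ, E) x →ₗ[ℝ] G)
  map_add' v v' := by
    ext w
    simp [TensorialAt.mkHom_apply_eq_extend, hessAlong]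
    abel
  map_smul' c v := by
    ext w
    simp [TensorialAt.mkHom_apply_eq_extend, hessAlong, smul_sub]

theorem hess_apply {f : M → G} {x : M} (hf : ContMDiffAt 𝓘(ℝ, E) 𝓘(ℝ, G) ∞ f x)
    (v : TangentSpace 𝓘(ℝ, E) x) {W : Π x : M, TangentSpace 𝓘(ℝ, E) x} (hW : MDiffAt (T% W) x) :
    hess hf v (W x) = hessAlong f x v W :=
  TensorialAt.mkHom_apply (hessAlong_tensorial hf v) hW

/-- On commuting coordinate fields the connection terms agree because the torsion vanishes; what is
left is the second derivative of `f` in the chart, which is symmetric. -/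
theorem hess_symm {f : M → G} {x : M} (hf : ContMDiffAt 𝓘(ℝ, E) 𝓘(ℝ, G) ∞ f x)
    (hf' : ∀ᶠ y in 𝓝 x, MDiffAt f y) (v w : TangentSpace 𝓘(ℝ, E) x) :
    hess hf v w = hess hf w v := by
  set e := chartAt E x
  have he : e ∈ IsManifold.maximalAtlas 𝓘(ℝ, E) ∞ M := IsManifold.chart_mem_maximalAtlas x
  have hx : x ∈ e.source := mem_chart_source E x
  obtain ⟨a, rfl⟩ : ∃ a, v = chartField e a x := ⟨_, (chartField_mfderiv he hx v).symm⟩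
  obtain ⟨b, rfl⟩ : ∃ b, w = chartField e b x := ⟨_, (chartField_mfderiv he hx w).symm⟩
  have hA := mdifferentiableAt_chartField he hx a
  have hB := mdifferentiableAt_chartField he hx b
  rw [hess_apply hf _ hA, hess_apply hf _ hB, hessAlong, hessAlong]
  have h0 := leviCivita_torsion_free hA hB
  rw [mlieBracket_chartField he hx, sub_eq_zero] at h0
  rw [h0]
  congr 1
  have hF : ContDiffAt ℝ ∞ (f ∘ e.symm) (e x) := by
    rw [← contMDiffAt_iff_contDiffAt]
    refine ContMDiffAt.comp (I' := 𝓘(ℝ, E)) _ ?_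
      (contMDiffAt_symm_of_mem_maximalAtlas he (e.map_source hx))
    rwa [e.left_inv hx]
  have hF' : DifferentiableAt ℝ (fderiv ℝ (f ∘ e.symm)) (e x) :=
    (hF.fderiv_right (m := ∞) (by simp)).differentiableAt (by simp)
  have key : ∀ c d : E, mvfderiv 𝓘(ℝ, E) (fun y ↦ mvfderiv 𝓘(ℝ, E) f y (chartField e c y)) x
      (chartField e d x) = fderiv ℝ (fderiv ℝ (f ∘ e.symm)) (e x) d c := by
    intro c d
    rw [mvfderiv_chartField he hx d
      (mdifferentiableAt_mvfderiv_apply hf (mdifferentiableAt_chartField he hx c))]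
    have h1 : ∀ᶠ z in 𝓝 (e x), ((fun y ↦ mvfderiv 𝓘(ℝ, E) f y (chartField e c y)) ∘ e.symm) z
        = fderiv ℝ (f ∘ e.symm) z c := by
      have hc : Tendsto e.symm (𝓝 (e x)) (𝓝 x) := by
        have := e.continuousAt_symm (e.map_source hx)
        rwa [ContinuousAt, e.left_inv hx] at this
      filter_upwards [hc.eventually hf', e.open_target.eventually_mem (e.map_source hx)]
        with z hz hz'
      rw [Function.comp_apply, mvfderiv_chartField he (e.map_target hz') c hz, e.right_inv hz']
    rw [EventuallyEq.fderiv_eq h1, fderiv_clm_apply hF' (differentiableAt_const c)]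
    simp
  rw [key, key]
  exact (hF.isSymmSndFDerivAt (by simpa using ENat.LEInfty.out)) _ _

end Hessian

/-! ### The composition formula for second fundamental forms -/

section Composition

variable {E : Type*} [NormedAddCommGroup E] [NormedSpace ℝ E] [FiniteDimensional ℝ E]
  {M : Type*} [TopologicalSpace M] [ChartedSpace E M] [IsManifold 𝓘(ℝ, E) ∞ M]
  {F : Type*} [NormedAddCommGroup F] [NormedSpace ℝ F] [FiniteDimensional ℝ F]
  {N : Type*} [TopologicalSpace N] [ChartedSpace F N] [IsManifold 𝓘(ℝ, F) ∞ N]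
  {G : Type*} [NormedAddCommGroup G] [NormedSpace ℝ G]
  {G' : Type*} [NormedAddCommGroup G'] [NormedSpace ℝ G']

theorem mvfderiv_clm_apply {A : M → G →L[ℝ] G'} {B : M → G} {x : M} (hA : MDiffAt A x)
    (hB : MDiffAt B x) (v : TangentSpace 𝓘(ℝ, E) x) :
    mvfderiv 𝓘(ℝ, E) (fun y ↦ A y (B y)) x v
      = mvfderiv 𝓘(ℝ, E) A x v (B x) + A x (mvfderiv 𝓘(ℝ, E) B x v) := by
  set e := chartAt E x
  have he : e ∈ IsManifold.maximalAtlas 𝓘(ℝ, E) ∞ M := IsManifold.chart_mem_maximalAtlas x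
  have hx : x ∈ e.source := mem_chart_source E x
  have hs : MDifferentiableAt 𝓘(ℝ, E) 𝓘(ℝ, E) e.symm (e x) :=
    (mdifferentiable_of_mem_maximalAtlas he).mdifferentiableAt_symm (e.map_source hx)
  have hA' : DifferentiableAt ℝ (A ∘ e.symm) (e x) := by
    rw [← mdifferentiableAt_iff_differentiableAt]
    refine MDifferentiableAt.comp (I' := 𝓘(ℝ, E)) _ ?_ hs
    rwa [e.left_inv hx]
  have hB' : DifferentiableAt ℝ (B ∘ e.symm) (e x) := by
    rw [← mdifferentiableAt_iff_differentiableAt]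
    refine MDifferentiableAt.comp (I' := 𝓘(ℝ, E)) _ ?_ hs
    rwa [e.left_inv hx]
  rw [mvfderiv_eq_fderiv he hx (hA.clm_apply hB), mvfderiv_eq_fderiv he hx hA,
    mvfderiv_eq_fderiv he hx hB]
  have := fderiv_clm_apply hA' hB'
  change fderiv ℝ (fun y ↦ (A ∘ e.symm) y ((B ∘ e.symm) y)) (e x) _ = _
  rw [this]
  simp only [Function.comp_apply, e.left_inv hx]
  exact add_comm _ _

theorem mvfderiv_comp_apply' {g : N → G} {φ : M → N} {x : M} (hg : MDiffAt g (φ x))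
    (hφ : MDiffAt φ x) (v : TangentSpace 𝓘(ℝ, E) x) :
    mvfderiv 𝓘(ℝ, E) (g ∘ φ) x v
      = mvfderiv 𝓘(ℝ, F) g (φ x) (mfderiv 𝓘(ℝ, E) 𝓘(ℝ, F) φ x v) :=
  mfderiv_comp_apply x hg hφ v

/-- The differential of a vector-valued function, read in the trivialization at `y₀`. -/
theorem exists_mvfderiv_coordinates {ψ : N → G} {y₀ : N}
    (hψ : ContMDiffAt 𝓘(ℝ, F) 𝓘(ℝ, G) ∞ ψ y₀) :
    ∃ D : N → F →L[ℝ] G, MDifferentiableAt 𝓘(ℝ, F) 𝓘(ℝ, F →L[ℝ] G) D y₀ ∧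
      ∀ y ∈ (trivializationAt F (fun y : N ↦ TangentSpace 𝓘(ℝ, F) y) y₀).baseSet,
        ∀ u : TangentSpace 𝓘(ℝ, F) y,
        D y (trivializationAt F (fun y : N ↦ TangentSpace 𝓘(ℝ, F) y) y₀ ⟨y, u⟩).2
          = mvfderiv 𝓘(ℝ, F) ψ y u := by
  refine ⟨_, (hψ.mfderiv_const (m := ∞) (by simp)).mdifferentiableAt (by simp), ?_⟩
  intro y hy u
  set t := trivializationAt F (fun y : N ↦ TangentSpace 𝓘(ℝ, F) y) y₀
  have h : t.symmL ℝ y (t ⟨y, u⟩).2 = u := by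
    rw [Trivialization.symmL_apply]
    · exact t.symm_apply_apply_mk hy u
    · exact hy
  change (trivializationAt G (TangentSpace 𝓘(ℝ, G)) (ψ y₀)).continuousLinearMapAt ℝ (ψ y)
    (mfderiv 𝓘(ℝ, F) 𝓘(ℝ, G) ψ y (t.symmL ℝ y (t ⟨y, u⟩).2)) = _
  rw [h]
  exact congrArg (fun L : G →L[ℝ] G ↦ L (mfderiv 𝓘(ℝ, F) 𝓘(ℝ, G) ψ y u))
    (TangentBundle.continuousLinearMapAt_model_space (𝕜 := ℝ) (ψ y₀) (ψ y))

variable [RiemannianBundle (fun x : M ↦ TangentSpace 𝓘(ℝ, E) x)]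
  [IsContMDiffRiemannianBundle 𝓘(ℝ, E) ∞ E (fun x : M ↦ TangentSpace 𝓘(ℝ, E) x)]
  [RiemannianBundle (fun y : N ↦ TangentSpace 𝓘(ℝ, F) y)]
  [IsContMDiffRiemannianBundle 𝓘(ℝ, F) ∞ F (fun y : N ↦ TangentSpace 𝓘(ℝ, F) y)]

/-- With `dψ` read as a matrix function `D` in a trivialization, the product rule splits `v(dψ(s))`
into the derivative of the coordinates of `s` and that of `D`. The first is the coordinate term of
`pullbackCov`; the second is the Hessian of `ψ` plus `dψ` of the connection term. -/
theorem mvfderiv_pullbackCov {ψ : N → G} {φ : M → N} {x : M}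
    (hψ : ContMDiffAt 𝓘(ℝ, F) 𝓘(ℝ, G) ∞ ψ (φ x))
    {s : Π x : M, TangentSpace 𝓘(ℝ, F) (φ x)}
    (hs : MDifferentiableAt 𝓘(ℝ, E) (𝓘(ℝ, F).prod 𝓘(ℝ, F))
      (fun z ↦ (⟨φ z, s z⟩ : TangentBundle 𝓘(ℝ, F) N)) x) (v : TangentSpace 𝓘(ℝ, E) x) :
    mvfderiv 𝓘(ℝ, F) ψ (φ x) (pullbackCov (E := E) (F := F) φ s x v)
      = mvfderiv 𝓘(ℝ, E) (fun z ↦ mvfderiv 𝓘(ℝ, F) ψ (φ z) (s z)) x v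
        - hess hψ (mfderiv 𝓘(ℝ, E) 𝓘(ℝ, F) φ x v) (s x) := by
  obtain ⟨D, hD, hDψ⟩ := exists_mvfderiv_coordinates hψ
  set t := trivializationAt F (fun y : N ↦ TangentSpace 𝓘(ℝ, F) y) (φ x) with ht
  have hx : φ x ∈ t.baseSet := FiberBundle.mem_baseSet_trivializationAt' (φ x)
  obtain ⟨hφ, hs'⟩ := (mdifferentiableAt_totalSpace _ _).1 hs
  simp only at hφ hs'
  have hbase : ∀ᶠ z in 𝓝 x, φ z ∈ t.baseSet :=
    hφ.continuousAt.eventually (t.open_baseSet.eventually_mem hx)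
  have h1 : mvfderiv 𝓘(ℝ, E) (fun z ↦ mvfderiv 𝓘(ℝ, F) ψ (φ z) (s z)) x v
      = mvfderiv 𝓘(ℝ, E) (fun z ↦ (D ∘ φ) z (t ⟨φ z, s z⟩).2) x v := by
    have : (fun z ↦ mvfderiv 𝓘(ℝ, F) ψ (φ z) (s z)) =ᶠ[𝓝 x] fun z ↦ (D ∘ φ) z (t ⟨φ z, s z⟩).2 :=
      hbase.mono fun z hz ↦ (hDψ _ hz _).symm
    exact congrArg (fun L : E →L[ℝ] G ↦ L v) this.mfderiv_eq
  rw [h1, mvfderiv_clm_apply (hD.comp x hφ) hs', mvfderiv_comp_apply' hD hφ]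
  set u := mfderiv 𝓘(ℝ, E) 𝓘(ℝ, F) φ x v with hu
  have h2 : hess hψ u (s x) = mvfderiv 𝓘(ℝ, F) D (φ x) u (t ⟨φ x, s x⟩).2
      - mvfderiv 𝓘(ℝ, F) ψ (φ x) (leviCivita F N (extend F (s x)) (φ x) u) := by
    have h3 := hess_apply hψ u (mdifferentiableAt_extend 𝓘(ℝ, F) F (s x))
    rw [extend_apply_self] at h3
    rw [h3, hessAlong]
    congr 1
    -- The extension has constant coordinates in `t`, so only `D` gets differentiated.
    have : (fun y ↦ mvfderiv 𝓘(ℝ, F) ψ y (extend F (s x) y))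
        =ᶠ[𝓝 (φ x)] fun y ↦ D y ((fun _ ↦ (t ⟨φ x, s x⟩).2) y) :=
      (t.open_baseSet.eventually_mem hx).mono fun y hy ↦ by
        refine (hDψ y hy (extend F (s x) y)).symm.trans ?_
        simp [extend, ← ht, t.apply_mk_symm hy]
    have h4 := mvfderiv_clm_apply hD (mdifferentiableAt_const (c := (t ⟨φ x, s x⟩).2)) u
    rw [mvfderiv_const] at h4
    simp only [zero_apply, map_zero, add_zero] at h4
    rw [← h4]
    exact congrArg (fun L : F →L[ℝ] G ↦ L u) this.mfderiv_eq
  rw [h2, pullbackCov, map_add, ← ht]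
  have h5 := hDψ (φ x) hx (t.symm (φ x) (mvfderiv 𝓘(ℝ, E) (fun z ↦ (t ⟨φ z, s z⟩).2) x v))
  rw [t.apply_mk_symm hx] at h5
  rw [← h5]
  simp only [Function.comp_apply]
  abel

theorem mdifferentiableAt_mfderiv_apply {φ : M → N} (hφ : ContMDiff 𝓘(ℝ, E) 𝓘(ℝ, F) ∞ φ)
    {x : M} {W : Π x : M, TangentSpace 𝓘(ℝ, E) x} (hW : MDiffAt (T% W) x) :
    MDifferentiableAt 𝓘(ℝ, E) (𝓘(ℝ, F).prod 𝓘(ℝ, F))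
      (fun z ↦ (⟨φ z, mfderiv 𝓘(ℝ, E) 𝓘(ℝ, F) φ z (W z)⟩ : TangentBundle 𝓘(ℝ, F) N)) x :=
  ((hφ.contMDiff_tangentMap (m := ∞) (by simp)).mdifferentiableAt (by simp)).comp x hW

/-- The chain rule `∇d(ψ ∘ φ) = dψ(∇dφ) + ∇dψ(dφ, dφ)`: apply the formula for `pullbackCov` to `s =
dφ(W)`, where `dψ(s) = d(ψ ∘ φ)(W)`. -/
theorem mvfderiv_mapSecondFundamentalForm {ψ : N → G} {φ : M → N}
    (hφ : ContMDiff 𝓘(ℝ, E) 𝓘(ℝ, F) ∞ φ) {x : M}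
    (hψ : ContMDiffAt 𝓘(ℝ, F) 𝓘(ℝ, G) ∞ ψ (φ x)) (hψ' : ∀ᶠ y in 𝓝 (φ x), MDiffAt ψ y)
    (hf : ContMDiffAt 𝓘(ℝ, E) 𝓘(ℝ, G) ∞ (ψ ∘ φ) x) (v w : TangentSpace 𝓘(ℝ, E) x) :
    mvfderiv 𝓘(ℝ, F) ψ (φ x) (mapSecondFundamentalForm (E := E) (F := F) φ x v w)
      = hess hf v w - hess hψ (mfderiv 𝓘(ℝ, E) 𝓘(ℝ, F) φ x v)
          (mfderiv 𝓘(ℝ, E) 𝓘(ℝ, F) φ x w) := by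
  have hW := mdifferentiableAt_extend 𝓘(ℝ, E) E w
  have h1 := hess_apply hf v hW
  have h2 := mvfderiv_pullbackCov hψ (mdifferentiableAt_mfderiv_apply hφ hW) v
  rw [extend_apply_self] at h1 h2
  rw [mapSecondFundamentalForm, map_sub, h2, h1, hessAlong,
    mvfderiv_comp_apply' (hψ.mdifferentiableAt (by simp)) (hφ.mdifferentiableAt (by simp))]
  have h3 : (fun z ↦ mvfderiv 𝓘(ℝ, E) (ψ ∘ φ) z (extend E w z)) =ᶠ[𝓝 x]
      fun z ↦ mvfderiv 𝓘(ℝ, F) ψ (φ z) (mfderiv 𝓘(ℝ, E) 𝓘(ℝ, F) φ z (extend E w z)) :=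
    (hφ.continuous.continuousAt.eventually hψ').mono fun z hz ↦
      mvfderiv_comp_apply' hz (hφ.mdifferentiableAt (by simp)) _
  have h4 : mvfderiv 𝓘(ℝ, E) (fun z ↦ mvfderiv 𝓘(ℝ, E) (ψ ∘ φ) z (extend E w z)) x v = _ :=
    congrArg (fun L : E →L[ℝ] G ↦ L v) h3.mfderiv_eq
  rw [h4]
  change _ = mvfderiv 𝓘(ℝ, E) (fun z ↦ mvfderiv 𝓘(ℝ, F) ψ (φ z)
    (mfderiv 𝓘(ℝ, E) 𝓘(ℝ, F) φ z (extend E w z))) x v - _ - _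
  abel

end Composition

/-! ### Differentiability of the fields `dφ^*(Y)` -/

section AdjointField

variable {E : Type*} [NormedAddCommGroup E] [NormedSpace ℝ E] [FiniteDimensional ℝ E]
  {M : Type*} [TopologicalSpace M] [ChartedSpace E M] [IsManifold 𝓘(ℝ, E) ∞ M]
  [RiemannianBundle (fun x : M ↦ TangentSpace 𝓘(ℝ, E) x)]
  [IsContMDiffRiemannianBundle 𝓘(ℝ, E) ∞ E (fun x : M ↦ TangentSpace 𝓘(ℝ, E) x)]

omit [RiemannianBundle (fun x : M ↦ TangentSpace 𝓘(ℝ, E) x)]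
  [IsContMDiffRiemannianBundle 𝓘(ℝ, E) ∞ E (fun x : M ↦ TangentSpace 𝓘(ℝ, E) x)] in
theorem mdifferentiableAt_fun_sum {G : Type*} {ι : Type} [NormedAddCommGroup G] [NormedSpace ℝ G]
    [Fintype ι] {f : ι → M → G} {x : M} (hf : ∀ i, MDiffAt (f i) x) :
    MDiffAt (fun y ↦ ∑ i, f i y) x := by
  have : (fun y ↦ ∑ i, f i y) = ∑ i, f i := by
    ext y
    simp
  rw [this]
  exact MDifferentiableAt.sum fun i _ ↦ hf i

/-- A vector field is differentiable if its inner products with a local frame are. -/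
theorem mdifferentiableAt_of_inner {A : Π x : M, TangentSpace 𝓘(ℝ, E) x} {x : M}
    (hA : ∀ w : TangentSpace 𝓘(ℝ, E) x, MDiffAt (fun y ↦ ⟪A y, extend E w y⟫_ℝ) x) :
    MDiffAt (T% A) x := by
  set t := trivializationAt E (fun y : M ↦ TangentSpace 𝓘(ℝ, E) y) x with ht
  have hx : x ∈ t.baseSet := FiberBundle.mem_baseSet_trivializationAt' x
  let b := stdOrthonormalBasis ℝ (TangentSpace 𝓘(ℝ, E) x)
  let L : TangentSpace 𝓘(ℝ, E) x ≃L[ℝ] E := t.continuousLinearEquivAt ℝ x hx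
  let X := fun i ↦ extend E (b i)
  have hX : ∀ i, MDiffAt (T% (X i)) x := fun i ↦ mdifferentiableAt_extend 𝓘(ℝ, E) E (b i)
  -- the projection `v ↦ ∑ i, ⟪v, X i⟫ X i`, read in the trivialization at its source only
  let P : M → E →L[ℝ] E := fun y ↦ ∑ i, ∑ j, ⟪X j y, X i y⟫_ℝ •
    ((innerSL ℝ (b j)).comp (L.symm : E →L[ℝ] TangentSpace 𝓘(ℝ, E) x)).smulRight (L (b i))
  have hP : MDifferentiableAt 𝓘(ℝ, E) 𝓘(ℝ, E →L[ℝ] E) P x := by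
    refine mdifferentiableAt_fun_sum fun i ↦ mdifferentiableAt_fun_sum fun j ↦ ?_
    exact (mdifferentiableAt_inner (hX j) (hX i)).smul mdifferentiableAt_const
  have hXL : ∀ y ∈ t.baseSet, ∀ v : TangentSpace 𝓘(ℝ, E) y,
      v = ∑ j, ⟪b j, L.symm (t ⟨y, v⟩).2⟫_ℝ • X j y := by
    intro y hy v
    have h1 : ∀ j, X j y = t.symmL ℝ y (L (b j)) := fun j ↦
      (t.symmL_apply hy _).symm
    simp only [h1, ← map_smul, ← map_sum]
    rw [b.sum_repr', L.apply_symm_apply, t.symmL_apply hy]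
    exact (t.symm_apply_apply_mk hy v).symm
  have hPA : ∀ y ∈ t.baseSet, ∀ v : TangentSpace 𝓘(ℝ, E) y,
      P y (t ⟨y, v⟩).2 = ∑ i, ⟪v, X i y⟫_ℝ • L (b i) := by
    intro y hy v
    simp only [P, sum_apply, smul_apply,
      ContinuousLinearMap.smulRight_apply, ContinuousLinearMap.comp_apply]
    refine Finset.sum_congr rfl fun i _ ↦ ?_
    conv_rhs => rw [hXL y hy v]
    rw [sum_inner, Finset.sum_smul]
    refine Finset.sum_congr rfl fun j _ ↦ ?_
    rw [real_inner_smul_left, smul_smul, mul_comm]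
    rfl
  have hPx : P x = 1 := by
    ext a
    obtain ⟨v, rfl⟩ := L.surjective a
    refine (hPA x hx v).trans ?_
    simp only [X, extend_apply_self, ← map_smul, ← map_sum]
    refine congrArg L ?_
    exact (Finset.sum_congr rfl fun i _ ↦ by rw [real_inner_comm]).trans (b.sum_repr' v)
  rw [mdifferentiableAt_totalSpace]
  refine ⟨mdifferentiableAt_id, ?_⟩
  -- `P` sends the coordinates of `A` to its inner products with the frame. It is the identity at
  -- `x`, hence invertible nearby, and its inverse recovers the coordinates from the inner products
  -- differentiably.
  have h1 : MDifferentiableAt 𝓘(ℝ, E) 𝓘(ℝ, E →L[ℝ] E) (fun y ↦ Ring.inverse (P y)) x :=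
    (differentiableAt_inverse (𝕜 := ℝ) (by rw [hPx]; exact isUnit_one)).comp_mdifferentiableAt hP
  have h2 : MDifferentiableAt 𝓘(ℝ, E) 𝓘(ℝ, E) (fun y ↦ ∑ i, ⟪A y, X i y⟫_ℝ • L (b i)) x :=
    mdifferentiableAt_fun_sum fun i ↦ (hA (b i)).smul mdifferentiableAt_const
  refine (h1.clm_apply h2).congr_of_eventuallyEq ?_
  have hu : ∀ᶠ y in 𝓝 x, IsUnit (P y) :=
    hP.continuousAt.eventually (Units.isOpen.eventually_mem (by rw [hPx]; exact isUnit_one))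
  filter_upwards [hu, t.open_baseSet.eventually_mem hx] with y hy hy'
  rw [← hPA y hy' (A y), ← mul_apply_eq_comp, Ring.inverse_mul_cancel _ hy]
  rfl

variable  {F : Type*} [NormedAddCommGroup F] [NormedSpace ℝ F] [FiniteDimensional ℝ F]
  {N : Type*} [TopologicalSpace N] [ChartedSpace F N] [IsManifold 𝓘(ℝ, F) ∞ N]
  [RiemannianBundle (fun y : N ↦ TangentSpace 𝓘(ℝ, F) y)]
  [IsContMDiffRiemannianBundle 𝓘(ℝ, F) ∞ F (fun y : N ↦ TangentSpace 𝓘(ℝ, F) y)]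

theorem inner_adjointDifferential (φ : M → N) (x : M) (u : TangentSpace 𝓘(ℝ, F) (φ x))
    (v : TangentSpace 𝓘(ℝ, E) x) :
    ⟪adjointDifferential (E := E) (F := F) φ x u, v⟫_ℝ
      = ⟪u, mfderiv 𝓘(ℝ, E) 𝓘(ℝ, F) φ x v⟫_ℝ :=
  LinearMap.adjoint_inner_left _ _ _

/-- Testing against `W` gives `⟪Y ∘ φ, dφ(W)⟫`, which is visibly differentiable, so the adjoint
never has to be written in coordinates. -/
theorem mdifferentiableAt_adjointDifferential {φ : M → N} (hφ : ContMDiff 𝓘(ℝ, E) 𝓘(ℝ, F) ∞ φ)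
    {x : M} {Y : Π y : N, TangentSpace 𝓘(ℝ, F) y} (hY : MDiffAt (T% Y) (φ x)) :
    MDiffAt (T% (fun z ↦ adjointDifferential (E := E) (F := F) φ z (Y (φ z)))) x := by
  refine mdifferentiableAt_of_inner fun w ↦ ?_
  simp only [inner_adjointDifferential]
  exact MDifferentiableAt.inner_bundle (F := F) (E := fun y : N ↦ TangentSpace 𝓘(ℝ, F) y)
    (b := φ) (hY.comp x (hφ.mdifferentiableAt (by simp)))
    (mdifferentiableAt_mfderiv_apply hφ (mdifferentiableAt_extend 𝓘(ℝ, E) E w))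

end AdjointField

/-! ### Holomorphic maps and the complex structure in the real setting -/

section Holomorphic

variable {F : Type*} [NormedAddCommGroup F] [NormedSpace ℂ F]
  {N : Type*} [TopologicalSpace N] [ChartedSpace F N]
  {G : Type*} [NormedAddCommGroup G] [NormedSpace ℂ G]

theorem hasMFDerivAt_restrictScalars {ψ : N → G} {y : N} {L : F →L[ℂ] G}
    (hψ : HasMFDerivAt 𝓘(ℂ, F) 𝓘(ℂ, G) ψ y L) :
    HasMFDerivAt 𝓘(ℝ, F) 𝓘(ℝ, G) ψ y (L.restrictScalars ℝ) :=
  ⟨hψ.1, hψ.2.restrictScalars ℝ⟩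

theorem _root_.MDifferentiableAt.complexToReal {ψ : N → G} {y : N}
    (hψ : MDifferentiableAt 𝓘(ℂ, F) 𝓘(ℂ, G) ψ y) : MDifferentiableAt 𝓘(ℝ, F) 𝓘(ℝ, G) ψ y :=
  (hasMFDerivAt_restrictScalars hψ.hasMFDerivAt).mdifferentiableAt

/-- The differential of a holomorphic map is complex linear. -/
theorem mvfderiv_complexStructure {ψ : N → G} {y : N}
    (hψ : MDifferentiableAt 𝓘(ℂ, F) 𝓘(ℂ, G) ψ y) (u : TangentSpace 𝓘(ℝ, F) y) :
    mvfderiv 𝓘(ℝ, F) ψ y (complexStructure y u) = Complex.I • mvfderiv 𝓘(ℝ, F) ψ y u := by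
  have h := (hasMFDerivAt_restrictScalars hψ.hasMFDerivAt).mfderiv
  change mfderiv 𝓘(ℝ, F) 𝓘(ℝ, G) ψ y (complexStructure y u)
    = (Complex.I • (show G from mfderiv 𝓘(ℝ, F) 𝓘(ℝ, G) ψ y u) : G)
  rw [h]
  exact (mfderiv 𝓘(ℂ, F) 𝓘(ℂ, G) ψ y).map_smul Complex.I u

theorem complexStructure_complexStructure (y : N) (u : TangentSpace 𝓘(ℝ, F) y) :
    complexStructure y (complexStructure y u) = -u := by
  change (Complex.I • Complex.I • (show F from u) : F) = -(show F from u)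
  rw [smul_smul, Complex.I_mul_I, neg_one_smul]

/-- Makes the holomorphic charts adapted to `P` available as charts of the real manifold `N`. -/
theorem mem_maximalAtlas_restrictScalars {e : OpenPartialHomeomorph N F}
    (he : e ∈ IsManifold.maximalAtlas 𝓘(ℂ, F) ω N) :
    e ∈ IsManifold.maximalAtlas 𝓘(ℝ, F) ∞ N := by
  have key : ∀ e₁ : OpenPartialHomeomorph F F, e₁ ∈ contDiffGroupoid ω 𝓘(ℂ, F) →
      e₁ ∈ contDiffGroupoid ∞ 𝓘(ℝ, F) := by
    intro e₁ h
    simp only [contDiffGroupoid, mem_groupoid_of_pregroupoid, contDiffPregroupoid] at h ⊢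
    exact ⟨(h.1.restrict_scalars ℝ).of_le le_top, (h.2.restrict_scalars ℝ).of_le le_top⟩
  rw [IsManifold.mem_maximalAtlas_iff, mem_maximalAtlas_iff] at he ⊢
  exact fun e' he' ↦ ⟨key _ (he e' he').1, key _ (he e' he').2⟩

variable [IsManifold 𝓘(ℂ, F) ω N]

theorem mdifferentiableAt_chartAt_complex {y z : N} (hz : z ∈ (chartAt F y).source) :
    MDifferentiableAt 𝓘(ℂ, F) 𝓘(ℂ, F) (chartAt F y) z :=
  (contMDiffAt_of_mem_maximalAtlas (n := ω) (IsManifold.chart_mem_maximalAtlas y)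
    hz).mdifferentiableAt (by simp)

variable [IsManifold 𝓘(ℝ, F) ∞ N]

/-- The differential of a holomorphic chart is complex linear, so in the trivialization at `y` the
field `JY` is `Y` multiplied by the constant `i`. -/
theorem mdifferentiableAt_complexStructure {Y : Π y : N, TangentSpace 𝓘(ℝ, F) y} {y : N}
    (hY : MDifferentiableAt 𝓘(ℝ, F) (𝓘(ℝ, F).prod 𝓘(ℝ, F))
      (fun z ↦ (⟨z, Y z⟩ : TangentBundle 𝓘(ℝ, F) N)) y) :
    MDifferentiableAt 𝓘(ℝ, F) (𝓘(ℝ, F).prod 𝓘(ℝ, F))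
      (fun z ↦ (⟨z, complexStructure z (Y z)⟩ : TangentBundle 𝓘(ℝ, F) N)) y := by
  rw [mdifferentiableAt_section] at hY ⊢
  have hd : Differentiable ℝ (fun a : F ↦ Complex.I • a) := differentiable_id.const_smul _
  refine (hd.comp_mdifferentiableAt hY).congr_of_eventuallyEq ?_
  filter_upwards [(chartAt F y).open_source.eventually_mem (mem_chart_source F y)] with z hz
  have h1 : ∀ u : TangentSpace 𝓘(ℝ, F) z,
      (trivializationAt F (TangentSpace 𝓘(ℝ, F)) y ⟨z, u⟩).2
        = mvfderiv 𝓘(ℝ, F) (chartAt F y) z u := by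
    intro u
    have h2 := TangentBundle.continuousLinearMapAt_trivializationAt (I := 𝓘(ℝ, F)) hz
    have h3 := (trivializationAt F (TangentSpace 𝓘(ℝ, F)) y).continuousLinearMapAt_apply_of_mem
      (R := ℝ) hz u
    rw [h2] at h3
    exact h3.symm
  rw [h1, Function.comp_apply, h1]
  exact mvfderiv_complexStructure (mdifferentiableAt_chartAt_complex hz) (Y z)

end Holomorphic

/-! ### Complex linearity of Hessians -/

section HessianHolomorphic

variable {F : Type*} [NormedAddCommGroup F] [NormedSpace ℂ F] [FiniteDimensional ℂ F]
  {N : Type*} [TopologicalSpace N] [ChartedSpace F N]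
  [IsManifold 𝓘(ℂ, F) ω N] [IsManifold 𝓘(ℝ, F) ∞ N]
  [RiemannianBundle (fun y : N ↦ TangentSpace 𝓘(ℝ, F) y)]
  [IsContMDiffRiemannianBundle 𝓘(ℝ, F) ∞ F (fun y : N ↦ TangentSpace 𝓘(ℝ, F) y)]
  {G : Type*} [NormedAddCommGroup G] [NormedSpace ℂ G]

/-- The conditions `∇J = 0` and PHH are imposed on fields smooth near a point; this extends a single
vector to such a field. -/
theorem exists_isSmoothNear_eq {E : Type*} [NormedAddCommGroup E] [NormedSpace ℝ E]
    [FiniteDimensional ℝ E] {M : Type*} [TopologicalSpace M] [ChartedSpace E M]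
    [IsManifold 𝓘(ℝ, E) ∞ M] {x : M} (w : TangentSpace 𝓘(ℝ, E) x) :
    ∃ W : Π x : M, TangentSpace 𝓘(ℝ, E) x, IsSmoothNear W x ∧ W x = w :=
  ⟨_, isSmoothNear_chartField (IsManifold.chart_mem_maximalAtlas x) (mem_chart_source E x) _,
    chartField_mfderiv (IsManifold.chart_mem_maximalAtlas x) (mem_chart_source E x) w⟩

theorem IsSmoothNear.mdifferentiableAt {E : Type*} [NormedAddCommGroup E] [NormedSpace ℝ E]
    {M : Type*} [TopologicalSpace M] [ChartedSpace E M]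
    [IsManifold 𝓘(ℝ, E) ∞ M] {x : M} {W : Π x : M, TangentSpace 𝓘(ℝ, E) x}
    (hW : IsSmoothNear W x) : MDiffAt (T% W) x :=
  (hW.self_of_nhds).mdifferentiableAt (by simp)

theorem mvfderiv_I_smul {E : Type*} [NormedAddCommGroup E] [NormedSpace ℝ E]
    {M : Type*} [TopologicalSpace M] [ChartedSpace E M] {h : M → G} {x : M}
    (hh : MDifferentiableAt 𝓘(ℝ, E) 𝓘(ℝ, G) h x)
    (v : TangentSpace 𝓘(ℝ, E) x) :
    mvfderiv 𝓘(ℝ, E) (fun z ↦ Complex.I • h z) x v = Complex.I • mvfderiv 𝓘(ℝ, E) h x v := by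
  let L : G →L[ℝ] G := (Complex.I • ContinuousLinearMap.id ℂ G).restrictScalars ℝ
  have h1 : mfderiv 𝓘(ℝ, E) 𝓘(ℝ, G) (L ∘ h) x = _ :=
    mfderiv_comp (I' := 𝓘(ℝ, G)) x L.differentiableAt.mdifferentiableAt hh
  rw [mfderiv_eq_fderiv, L.fderiv] at h1
  exact congrArg (fun T : E →L[ℝ] G ↦ T v) h1

/-- On a Kähler manifold the Hessian of a holomorphic map is complex linear. -/
theorem hess_complexStructure (hN : IsKahler F N) {ψ : N → G} {y : N}
    (hψ : ContMDiffAt 𝓘(ℝ, F) 𝓘(ℝ, G) ∞ ψ y)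
    (hψ' : ∀ᶠ z in 𝓝 y, MDifferentiableAt 𝓘(ℂ, F) 𝓘(ℂ, G) ψ z)
    (u w : TangentSpace 𝓘(ℝ, F) y) :
    hess hψ u (complexStructure y w) = Complex.I • hess hψ u w := by
  obtain ⟨W, hW, rfl⟩ := exists_isSmoothNear_eq w
  have hW' := hW.mdifferentiableAt
  have h0 := hess_apply hψ u (mdifferentiableAt_complexStructure hW')
  rw [h0, hess_apply hψ u hW', hessAlong, hessAlong, hN.2 y W hW u, mvfderiv_complexStructure hψ'.self_of_nhds, smul_sub,
    ← mvfderiv_I_smul (mdifferentiableAt_mvfderiv_apply hψ hW')]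
  congr 1
  have h1 : (fun z ↦ mvfderiv 𝓘(ℝ, F) ψ z (complexStructure z (W z))) =ᶠ[𝓝 y]
      fun z ↦ Complex.I • mvfderiv 𝓘(ℝ, F) ψ z (W z) :=
    hψ'.mono fun z hz ↦ mvfderiv_complexStructure hz _
  exact congrArg (fun L : F →L[ℝ] G ↦ L u) h1.mfderiv_eq

variable {E : Type*} [NormedAddCommGroup E] [NormedSpace ℝ E] [FiniteDimensional ℝ E]
  {M : Type*} [TopologicalSpace M] [ChartedSpace E M] [IsManifold 𝓘(ℝ, E) ∞ M]
  [RiemannianBundle (fun x : M ↦ TangentSpace 𝓘(ℝ, E) x)]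
  [IsContMDiffRiemannianBundle 𝓘(ℝ, E) ∞ E (fun x : M ↦ TangentSpace 𝓘(ℝ, E) x)]

/-- For a pseudo-horizontally homothetic map `φ` and a holomorphic `ψ`, the Hessian of `ψ ∘ φ` is
complex linear in the horizontal directions. -/
theorem hess_comp_adjointDifferential {φ : M → N} (hφ : ContMDiff 𝓘(ℝ, E) 𝓘(ℝ, F) ∞ φ)
    (hPHH : IsPHH (E := E) (F := F) φ) {ψ : N → G} {x : M}
    (hψ' : ∀ᶠ z in 𝓝 (φ x), MDifferentiableAt 𝓘(ℂ, F) 𝓘(ℂ, G) ψ z)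
    (hf : ContMDiffAt 𝓘(ℝ, E) 𝓘(ℝ, G) ∞ (ψ ∘ φ) x) {v : TangentSpace 𝓘(ℝ, E) x}
    (hv : v ∈ horizontalSpace (E := E) (F := F) φ x) (a : TangentSpace 𝓘(ℝ, F) (φ x)) :
    hess hf v (adjointDifferential (E := E) (F := F) φ x (complexStructure (φ x) a))
      = Complex.I • hess hf v (adjointDifferential (E := E) (F := F) φ x a) := by
  obtain ⟨Y, hY, rfl⟩ := exists_isSmoothNear_eq a
  have hW := mdifferentiableAt_adjointDifferential (E := E) hφ hY.mdifferentiableAt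
  have hW' := mdifferentiableAt_adjointDifferential (E := E) hφ
    (mdifferentiableAt_complexStructure hY.mdifferentiableAt)
  have hφ' : ∀ z, MDifferentiableAt 𝓘(ℝ, E) 𝓘(ℝ, F) φ z := fun z ↦ hφ.mdifferentiableAt (by simp)
  have hd : ∀ u, mvfderiv 𝓘(ℝ, E) (ψ ∘ φ) x u
      = mvfderiv 𝓘(ℝ, F) ψ (φ x) (mfderiv 𝓘(ℝ, E) 𝓘(ℝ, F) φ x u) := fun u ↦
    mvfderiv_comp_apply' hψ'.self_of_nhds.complexToReal (hφ' x) u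
  have h0 := hess_apply hf v hW
  have h0' := hess_apply hf v hW'
  rw [h0, h0', hessAlong, hessAlong, hd, hd,
    (hPHH x).2 v hv Y hY, mvfderiv_complexStructure hψ'.self_of_nhds, smul_sub,
    ← mvfderiv_I_smul (mdifferentiableAt_mvfderiv_apply hf hW)]
  congr 1
  -- This identity is about to be differentiated, so commutation of `dφ ∘ dφ^*` with `J` is used at
  -- all points near `x`. The connection term was settled above by the second PHH condition at `x`.
  have h1 : (fun z ↦ mvfderiv 𝓘(ℝ, E) (ψ ∘ φ) z
      (adjointDifferential (E := E) (F := F) φ z (complexStructure (φ z) (Y (φ z))))) =ᶠ[𝓝 x]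
      fun z ↦ Complex.I • mvfderiv 𝓘(ℝ, E) (ψ ∘ φ) z
        (adjointDifferential (E := E) (F := F) φ z (Y (φ z))) := by
    filter_upwards [hφ.continuous.continuousAt.eventually hψ'] with z hz
    rw [mvfderiv_comp_apply' hz.complexToReal (hφ' z), mvfderiv_comp_apply' hz.complexToReal (hφ' z),
      (hPHH z).1, mvfderiv_complexStructure hz]
  exact congrArg (fun L : E →L[ℝ] G ↦ L v) h1.mfderiv_eq

end HessianHolomorphic

/-! ### Local form of a submersion -/

section Submersion

variable {E : Type*} [NormedAddCommGroup E] [NormedSpace ℝ E] [FiniteDimensional ℝ E]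
  {F : Type*} [NormedAddCommGroup F] [NormedSpace ℝ F] [FiniteDimensional ℝ F]

/-- Local form of a submersion between vector spaces: up to a change of coordinates in the source
it is its differential. -/
theorem exists_openPartialHomeomorph_fderiv_comp_eq {g : E → F} {O : Set E} (hO : IsOpen O)
    (hg : ContDiffOn ℝ ∞ g O) {a : E} (ha : a ∈ O) (hs : Function.Surjective (fderiv ℝ g a)) :
    ∃ h : OpenPartialHomeomorph E E, a ∈ h.source ∧ h.source ⊆ O ∧ ContDiffOn ℝ ∞ h h.source ∧
      ContDiffOn ℝ ∞ h.symm h.target ∧ ∀ z ∈ h.source, fderiv ℝ g a (h z) = g z := by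
  set T := fderiv ℝ g a with hT
  obtain ⟨R₀, hR₀⟩ := (T : E →ₗ[ℝ] F).exists_rightInverse_of_surjective
    (LinearMap.range_eq_top.2 hs)
  set R : F →L[ℝ] E := LinearMap.toContinuousLinearMap R₀ with hR
  have hTR : ∀ u, T (R u) = u := fun u ↦ LinearMap.congr_fun hR₀ u
  -- Since `T ∘ R = id`, applying `T` to `Φ z` gives exactly `g z`; and `Φ` has derivative `id` at
  -- `a` because `g - T` has derivative zero there.
  set Φ : E → E := fun z ↦ z + R (g z - T z) with hΦ
  have hΦO : ContDiffOn ℝ ∞ Φ O :=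
    contDiffOn_id.add (R.contDiff.comp_contDiffOn (hg.sub T.contDiff.contDiffOn))
  have hΦa : ∀ z ∈ O, ContDiffAt ℝ ∞ Φ z := fun z hz ↦ hΦO.contDiffAt (hO.mem_nhds hz)
  have hga : HasFDerivAt g T a :=
    ((hg.contDiffAt (hO.mem_nhds ha)).differentiableAt (by simp)).hasFDerivAt
  have hda : HasFDerivAt Φ ((ContinuousLinearEquiv.refl ℝ E : E ≃L[ℝ] E) : E →L[ℝ] E) a := by
    have := (hasFDerivAt_id a).add (R.hasFDerivAt.comp a (hga.sub T.hasFDerivAt))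
    rw [sub_self, ContinuousLinearMap.comp_zero, add_zero] at this
    exact this
  set h₀ := (hΦa a ha).toOpenPartialHomeomorph Φ hda (by simp) with hh₀
  have hh₀c : (h₀ : E → E) = Φ := (hΦa a ha).toOpenPartialHomeomorph_coe hda (by simp)
  -- Shrinking to points where `dΦ` is invertible makes the inverse smooth on the whole target, not
  -- only at `Φ a`.
  set W := O ∩ fderiv ℝ Φ ⁻¹' Set.range ((↑) : (E ≃L[ℝ] E) → E →L[ℝ] E) with hW
  have hWo : IsOpen W := (hΦO.continuousOn_fderiv_of_isOpen hO (by simp)).isOpen_inter_preimage hO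
    ContinuousLinearEquiv.isOpen
  refine ⟨h₀.restrOpen W hWo, ?_, ?_, ?_, ?_, ?_⟩
  · exact ⟨(hΦa a ha).mem_toOpenPartialHomeomorph_source hda (by simp), ha,
      ⟨_, hda.fderiv.symm⟩⟩
  · exact fun z hz ↦ hz.2.1
  · have : (h₀.restrOpen W hWo : E → E) = Φ := hh₀c
    rw [this]
    exact hΦO.mono fun z hz ↦ hz.2.1
  · intro z hz
    have hz' := (h₀.restrOpen W hWo).map_target hz
    obtain ⟨L, hL⟩ := hz'.2.2
    refine ((h₀.restrOpen W hWo).contDiffAt_symm (f₀' := L) hz ?_ ?_).contDiffWithinAt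
    · change HasFDerivAt h₀ _ _
      rw [hh₀c, hL]
      exact ((hΦa _ hz'.2.1).differentiableAt (by simp)).hasFDerivAt
    · change ContDiffAt ℝ ∞ h₀ _
      rw [hh₀c]
      exact hΦa _ hz'.2.1
  · intro z _
    change T (h₀ z) = g z
    rw [hh₀c]
    simp [hΦ, hTR]

variable {M : Type*} [TopologicalSpace M] [ChartedSpace E M] [IsManifold 𝓘(ℝ, E) ∞ M]
  {N : Type*} [TopologicalSpace N] [ChartedSpace F N] [IsManifold 𝓘(ℝ, F) ∞ N]

/-- Local form of a submersion. -/
theorem exists_chart_comp_eq_linear {φ : M → N} (hφ : ContMDiff 𝓘(ℝ, E) 𝓘(ℝ, F) ∞ φ) {x : M}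
    (hs : Function.Surjective (mfderiv 𝓘(ℝ, E) 𝓘(ℝ, F) φ x)) {e : OpenPartialHomeomorph N F}
    (he : e ∈ IsManifold.maximalAtlas 𝓘(ℝ, F) ∞ N) (hx : φ x ∈ e.source) :
    ∃ e' ∈ IsManifold.maximalAtlas 𝓘(ℝ, E) ∞ M, x ∈ e'.source ∧
      (∀ z ∈ e'.source, φ z ∈ e.source) ∧
      ∃ T : E →L[ℝ] F, Function.Surjective T ∧ ∀ z ∈ e'.source, e (φ z) = T (e' z) := by
  set c := chartAt E x with hc
  have hcx : x ∈ c.source := mem_chart_source E x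
  have hcm : c ∈ IsManifold.maximalAtlas 𝓘(ℝ, E) ∞ M := IsManifold.chart_mem_maximalAtlas x
  set O := c.target ∩ c.symm ⁻¹' (φ ⁻¹' e.source) with hO
  have hOo : IsOpen O :=
    c.isOpen_inter_preimage_symm (e.open_source.preimage hφ.continuous)
  have hef : ContMDiffAt 𝓘(ℝ, E) 𝓘(ℝ, F) ∞ (e ∘ φ) x :=
    (contMDiffAt_of_mem_maximalAtlas he hx).comp x hφ.contMDiffAt
  have hg : ContDiffOn ℝ ∞ ((e ∘ φ) ∘ c.symm) O := by
    rw [← contMDiffOn_iff_contDiffOn]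
    intro z hz
    refine ContMDiffAt.contMDiffWithinAt ?_
    exact ((contMDiffAt_of_mem_maximalAtlas he hz.2).comp _ hφ.contMDiffAt).comp z
      (contMDiffAt_symm_of_mem_maximalAtlas hcm hz.1)
  have hsurj : Function.Surjective (fderiv ℝ ((e ∘ φ) ∘ c.symm) (c x)) := by
    intro u
    obtain ⟨u', hu'⟩ := (mdifferentiable_of_mem_maximalAtlas he).mfderiv_surjective hx u
    obtain ⟨v, hv⟩ := hs u'
    refine ⟨mfderiv 𝓘(ℝ, E) 𝓘(ℝ, E) c x v, ?_⟩
    rw [← mvfderiv_eq_fderiv hcm hcx (hef.mdifferentiableAt (by simp)),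
      mvfderiv_comp_apply' ((contMDiffAt_of_mem_maximalAtlas he hx).mdifferentiableAt (by simp))
        (hφ.contMDiffAt.mdifferentiableAt (by simp)), hv]
    exact hu'
  obtain ⟨h, hh, hhO, hh1, hh2, hhT⟩ := exists_openPartialHomeomorph_fderiv_comp_eq hOo hg
    (a := c x) ⟨c.map_source hcx, by simpa [c.left_inv hcx] using hx⟩ hsurj
  refine ⟨c ≫ₕ h, ?_, ⟨hcx, hh⟩, ?_, _, hsurj, ?_⟩
  · refine OpenPartialHomeomorph.mem_maximalAtlas_of_contMDiffOn _ ?_ ?_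
    · intro z hz
      refine ContMDiffAt.contMDiffWithinAt ?_
      exact (hh1.contDiffAt (h.open_source.mem_nhds hz.2)).contMDiffAt.comp z
        (contMDiffAt_of_mem_maximalAtlas hcm hz.1)
    · intro z hz
      refine ContMDiffAt.contMDiffWithinAt ?_
      have hz' : z ∈ h.target ∩ h.symm ⁻¹' c.target := by
        simpa [OpenPartialHomeomorph.trans_target] using hz
      exact (contMDiffAt_symm_of_mem_maximalAtlas hcm hz'.2).comp z
        (hh2.contDiffAt (h.open_target.mem_nhds hz'.1)).contMDiffAt
  · intro z hz
    simpa [c.left_inv hz.1] using (hhO hz.2).2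
  · intro z hz
    have h1 : fderiv ℝ ((e ∘ φ) ∘ c.symm) (c x) (h (c z)) = e (φ (c.symm (c z))) := hhT _ hz.2
    rw [c.left_inv hz.1] at h1
    exact h1.symm

end Submersion

/-! ### Tangent space and second fundamental form of a submanifold -/

section TangentSubspace

variable {E : Type*} [NormedAddCommGroup E] [NormedSpace ℝ E] [FiniteDimensional ℝ E]
  {M : Type*} [TopologicalSpace M] [ChartedSpace E M] [IsManifold 𝓘(ℝ, E) ∞ M]
  {G : Type*} [NormedAddCommGroup G] [NormedSpace ℝ G] [FiniteDimensional ℝ G]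
  {H : Type*} [NormedAddCommGroup H] [NormedSpace ℝ H]
  {K : Set M} {e : OpenPartialHomeomorph M E}
  (he : e ∈ IsManifold.maximalAtlas 𝓘(ℝ, E) ∞ M)
  {Q : E →L[ℝ] G} (hK : ∀ z ∈ e.source, z ∈ K ↔ Q (e z) = 0)

include he hK

/-- In the chart, the straight line through `e x` in a direction of `ker Q` stays in `K`, and `f`
vanishes along it. Only differentiability of `f` at `x` is needed. -/
theorem mvfderiv_eq_zero_of_eventuallyEq_zero {x : M} (hx : x ∈ e.source) (hxK : x ∈ K)
    {f : M → H} (hf : MDiffAt f x) (h0 : ∀ᶠ y in 𝓝[K] x, f y = 0) {v : TangentSpace 𝓘(ℝ, E) x}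
    (hv : Q (mfderiv 𝓘(ℝ, E) 𝓘(ℝ, E) e x v) = 0) : mvfderiv 𝓘(ℝ, E) f x v = 0 := by
  set b : E := mfderiv 𝓘(ℝ, E) 𝓘(ℝ, E) e x v with hb
  have hf' : MDifferentiableAt 𝓘(ℝ, E) 𝓘(ℝ, H) (f ∘ e.symm) (e x) := by
    refine MDifferentiableAt.comp (I' := 𝓘(ℝ, E)) _ ?_
      ((mdifferentiable_of_mem_maximalAtlas he).mdifferentiableAt_symm (e.map_source hx))
    rwa [e.left_inv hx]
  have hf'' : DifferentiableAt ℝ (f ∘ e.symm) (e x) := hf'.differentiableAt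
  rw [mvfderiv_eq_fderiv he hx hf, ← hb, ← hf''.lineDeriv_eq_fderiv, lineDeriv]
  have hline : ∀ᶠ t : ℝ in 𝓝 0, (f ∘ e.symm) (e x + t • b) = 0 := by
    have hcont : Tendsto (fun t : ℝ ↦ e x + t • b) (𝓝 0) (𝓝 (e x)) := by
      have : Continuous fun t : ℝ ↦ e x + t • b := by fun_prop
      simpa using this.tendsto 0
    have h1 : ∀ᶠ t : ℝ in 𝓝 0, e x + t • b ∈ e.target :=
      hcont.eventually (e.open_target.eventually_mem (e.map_source hx))
    have h2 : ∀ᶠ t : ℝ in 𝓝 0, e.symm (e x + t • b) ∈ K → f (e.symm (e x + t • b)) = 0 := by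
      have h3 : Tendsto e.symm (𝓝 (e x)) (𝓝 x) := by
        simpa [e.left_inv hx] using (e.continuousAt_symm (e.map_source hx)).tendsto
      exact (h3.comp hcont).eventually (eventually_nhdsWithin_iff.1 h0)
    filter_upwards [h1, h2] with t ht1 ht2
    refine ht2 ((hK _ (e.map_target ht1)).2 ?_)
    rw [e.right_inv ht1, map_add, map_smul, hv, (hK x hx).1 hxK]
    simp
  have : (fun t : ℝ ↦ (f ∘ e.symm) (e x + t • b)) =ᶠ[𝓝 0] fun _ ↦ (0 : H) := hline
  rw [this.deriv_eq, deriv_const]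

/-- The tangent space of the submanifold `{Q ∘ e = 0}` is the kernel of `Q ∘ de`. -/
theorem mem_tangentSubspace_iff {x : M} (hx : x ∈ e.source) (hxK : x ∈ K)
    {v : TangentSpace 𝓘(ℝ, E) x} :
    v ∈ tangentSubspace K x ↔ Q (mfderiv 𝓘(ℝ, E) 𝓘(ℝ, E) e x v) = 0 := by
  refine ⟨fun hv ↦ ?_, fun hv f hf h0 ↦ mvfderiv_eq_zero_of_eventuallyEq_zero he hK hx hxK
    (hf.self_of_nhds.mdifferentiableAt (by simp)) h0 hv⟩
  -- The functions `ℓ ∘ Q ∘ e` vanish on `K`, and they suffice to detect `Q (de v)`.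
  refine SeparatingDual.eq_zero_of_forall_dual_eq_zero (R := ℝ) fun ℓ ↦ ?_
  have hsm : ∀ y ∈ e.source, ContMDiffAt 𝓘(ℝ, E) 𝓘(ℝ, ℝ) ∞ ((ℓ ∘L Q) ∘ e) y := fun y hy ↦
    (ℓ ∘L Q).contMDiff.contMDiffAt.comp y (contMDiffAt_of_mem_maximalAtlas he hy)
  have h1 := hv ((ℓ ∘L Q) ∘ e) ((e.open_source.eventually_mem hx).mono hsm) (by
    filter_upwards [nhdsWithin_le_nhds (e.open_source.eventually_mem hx), self_mem_nhdsWithin]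
      with y hy hyK
    simp [(hK y hy).1 hyK])
  have hL : MDifferentiableAt 𝓘(ℝ, E) 𝓘(ℝ, ℝ) (ℓ ∘L Q) (e x) :=
    (ℓ ∘L Q).differentiableAt.mdifferentiableAt
  rw [mvfderiv_comp_apply' hL
    ((contMDiffAt_of_mem_maximalAtlas he hx).mdifferentiableAt (by simp))] at h1
  rw [← h1]
  have h2 : mfderiv 𝓘(ℝ, E) 𝓘(ℝ, ℝ) (ℓ ∘L Q) (e x) = ℓ ∘L Q := by
    rw [mfderiv_eq_fderiv]
    exact (ℓ ∘L Q).fderiv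
  exact (congrArg (fun L : E →L[ℝ] ℝ ↦ L (mfderiv 𝓘(ℝ, E) 𝓘(ℝ, E) e x v)) h2).symm

/-- Constant coordinates in `ker Q` are tangent to `K` at every nearby point of `K`. Hence tangent
extensions exist and `secondFundamentalForm` does not take its default value `0`. -/
theorem isTangentExtension_chartField {x : M} (hx : x ∈ e.source) (hxK : x ∈ K)
    {w : TangentSpace 𝓘(ℝ, E) x} (hw : w ∈ tangentSubspace K x) :
    IsTangentExtension K x w (chartField e (mfderiv 𝓘(ℝ, E) 𝓘(ℝ, E) e x w)) := by
  refine ⟨isSmoothNear_chartField he hx _, ?_, chartField_mfderiv he hx w⟩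
  filter_upwards [nhdsWithin_le_nhds (e.open_source.eventually_mem hx), self_mem_nhdsWithin]
    with y hy hyK
  refine (mem_tangentSubspace_iff he hK hy hyK).2 ?_
  exact (congrArg Q (mfderiv_chartField he hy _)).trans
    ((mem_tangentSubspace_iff he hK hx hxK).1 hw)

variable [RiemannianBundle (fun x : M ↦ TangentSpace 𝓘(ℝ, E) x)]
  [IsContMDiffRiemannianBundle 𝓘(ℝ, E) ∞ E (fun x : M ↦ TangentSpace 𝓘(ℝ, E) x)]

/-- For a function whose differential vanishes exactly on the tangent spaces of `K`, the
differential takes the second fundamental form of `K` to minus the Hessian. -/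
theorem mvfderiv_secondFundamentalForm {f : M → H} {x : M} (hx : x ∈ e.source) (hxK : x ∈ K)
    (hf : ContMDiffAt 𝓘(ℝ, E) 𝓘(ℝ, H) ∞ f x)
    (hfK : ∀ᶠ y in 𝓝[K] x, ∀ u ∈ tangentSubspace K y, mvfderiv 𝓘(ℝ, E) f y u = 0)
    {v w : TangentSpace 𝓘(ℝ, E) x} (hv : v ∈ tangentSubspace K x)
    (hw : w ∈ tangentSubspace K x) :
    mvfderiv 𝓘(ℝ, E) f x (secondFundamentalForm K x v w) = -hess hf v w := by
  have hex : ∃ W, IsTangentExtension K x w W :=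
    ⟨_, isTangentExtension_chartField he hK hx hxK hw⟩
  obtain ⟨hW1, hW2, hW3⟩ := hex.choose_spec
  set W := hex.choose with hW
  have hWd : MDiffAt (T% W) x := hW1.mdifferentiableAt
  have h1 := hess_apply hf v hWd
  rw [hW3] at h1
  -- `df(W)` vanishes along `K` and `v` is tangent to `K`, so only `-df(∇_v W)` survives in the
  -- Hessian.
  have h2 : mvfderiv 𝓘(ℝ, E) (fun y ↦ mvfderiv 𝓘(ℝ, E) f y (W y)) x v = 0 := by
    refine mvfderiv_eq_zero_of_eventuallyEq_zero he hK hx hxK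
      (mdifferentiableAt_mvfderiv_apply hf hWd) ?_ ((mem_tangentSubspace_iff he hK hx hxK).1 hv)
    filter_upwards [hfK, hW2] with y hy hy'
    exact hy _ hy'
  -- Projecting to the normal space removes a tangential part, which `df` kills anyway.
  have h3 : secondFundamentalForm K x v w
      = leviCivita E M W x v
        - (tangentSubspace (E := E) K x).starProjection (leviCivita E M W x v) := by
    rw [secondFundamentalForm, dif_pos hex, Submodule.starProjection_orthogonal_val]
  rw [h1, hessAlong, h2, h3, map_sub,
    hfK.self_of_nhdsWithin hxK _ (Submodule.starProjection_apply_mem _ _)]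
  simp

end TangentSubspace

/-! ### Vanishing of the trace on horizontal complex subspaces -/

section LinearAlgebra

variable {T U G : Type*} [NormedAddCommGroup T] [InnerProductSpace ℝ T] [FiniteDimensional ℝ T]
  [NormedAddCommGroup U] [InnerProductSpace ℝ U] [FiniteDimensional ℝ U]
  [AddCommGroup G] [Module ℂ G]

/-- A symmetric bilinear map that is complex linear along the complex structure carried by
`D.adjoint` to `(ker D)ᗮ` is trace free on the orthogonal complement of every subspace
`D⁻¹ C` with `C` complex. -/
theorem traceOn_orthogonal_comap_eq_zero {D : T →ₗ[ℝ] U} (hD : Function.Surjective D)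
    {J : U →ₗ[ℝ] U} (hJJ : ∀ u, J (J u) = -u) (hJ : ∀ u v, ⟪J u, J v⟫_ℝ = ⟪u, v⟫_ℝ)
    (hDJ : ∀ u, D (D.adjoint (J u)) = J (D (D.adjoint u))) {b : T →ₗ[ℝ] T →ₗ[ℝ] G}
    (hb : ∀ u v, b u v = b v u)
    (hbJ : ∀ v ∈ D.kerᗮ, ∀ a, b v (D.adjoint (J a)) = Complex.I • b v (D.adjoint a))
    {C : Submodule ℝ U} (hC : ∀ c ∈ C, J c ∈ C) : traceOn b (C.comap D)ᗮ = 0 := by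
  have hinj : Function.Injective D.adjoint := by
    refine (injective_iff_map_eq_zero _).2 fun a ha ↦ ?_
    obtain ⟨v, rfl⟩ := hD a
    have := LinearMap.adjoint_inner_left D v (D v)
    rw [ha, inner_zero_left] at this
    exact inner_self_eq_zero.1 this.symm
  obtain ⟨R, hR⟩ := D.adjoint.exists_leftInverse_of_injective (LinearMap.ker_eq_bot.2 hinj)
  have hR' : ∀ a, R (D.adjoint a) = a := LinearMap.congr_fun hR
  have hmem : ∀ a, D.adjoint a ∈ D.kerᗮ := fun a ↦ by
    rw [LinearMap.orthogonal_ker]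
    exact ⟨a, rfl⟩
  have hex : ∀ u ∈ (C.comap D)ᗮ, ∃ a, D.adjoint a = u := fun u hu ↦ by
    have : u ∈ D.kerᗮ := Submodule.orthogonal_le (LinearMap.ker_le_comap D) hu
    rwa [LinearMap.orthogonal_ker] at this
  have hskew : ∀ u v, ⟪u, J v⟫_ℝ = -⟪J u, v⟫_ℝ := fun u v ↦ by
    rw [← hJ u (J v), hJJ, inner_neg_right]
  -- `R` inverts `D.adjoint` on its range `(ker D)ᗮ`, so this map is `J` transported there: it sends
  -- `D.adjoint a` to `D.adjoint (J a)`.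
  refine traceOn_eq_zero b _ (D.adjoint ∘ₗ J ∘ₗ R) ?_ ?_ ?_
  · intro u hu
    obtain ⟨a, rfl⟩ := hex u hu
    rw [Submodule.mem_orthogonal] at hu ⊢
    intro t ht
    -- `D.adjoint a` is orthogonal to `D⁻¹ C` exactly when `a` is orthogonal to `C`, and `J`
    -- preserves `Cᗮ` because it is skew and preserves `C`.
    obtain ⟨t', ht'⟩ := hD (J (D t))
    have h2 := hu t' (show D t' ∈ C from ht' ▸ hC _ ht)
    rw [LinearMap.adjoint_inner_right, ht'] at h2
    simp only [LinearMap.comp_apply, hR', LinearMap.adjoint_inner_right]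
    rw [hskew, h2, neg_zero]
  · intro u hu
    obtain ⟨a, rfl⟩ := hex u hu
    simp only [LinearMap.comp_apply, hR', @norm_eq_sqrt_real_inner T]
    -- Isometry: `⟪J a, D D^* J a⟫ = ⟪J a, J D D^* a⟫ = ⟪a, D D^* a⟫`.
    rw [LinearMap.adjoint_inner_left, hDJ, hJ, LinearMap.adjoint_inner_left]
  · intro u hu
    obtain ⟨a, rfl⟩ := hex u hu
    simp only [LinearMap.comp_apply, hR']
    rw [hbJ _ (hmem _), hb, hbJ _ (hmem _), smul_smul, Complex.I_mul_I, neg_one_smul]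

end LinearAlgebra

/-! ### Preimages of complex submanifolds and the tension field -/

section Preimage

variable {E : Type*} [NormedAddCommGroup E] [NormedSpace ℝ E] [FiniteDimensional ℝ E]
  {M : Type*} [TopologicalSpace M] [ChartedSpace E M] [IsManifold 𝓘(ℝ, E) ∞ M]
  {F : Type*} [NormedAddCommGroup F] [NormedSpace ℂ F] [FiniteDimensional ℂ F]
  {N : Type*} [TopologicalSpace N] [ChartedSpace F N]
  [IsManifold 𝓘(ℂ, F) ω N] [IsManifold 𝓘(ℝ, F) ∞ N]

/-- The preimage of a complex submanifold `P` under a submersion `φ` is locally the zero set of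
`ψ ∘ φ` with `ψ` holomorphic, and `ψ ∘ φ` is linear in a suitable chart. -/
theorem exists_chart_comp_eq_linear_of_isEmbeddedSubmanifold {φ : M → N}
    (hφ : ContMDiff 𝓘(ℝ, E) 𝓘(ℝ, F) ∞ φ) (hsub : IsSubmersionMap (E := E) (F := F) φ)
    {P : Set N} {p : ℕ} (hP : IsEmbeddedSubmanifold ℂ (E := F) ω P p) {x : M} (hx : φ x ∈ P) :
    ∃ e ∈ IsManifold.maximalAtlas 𝓘(ℝ, E) ∞ M, x ∈ e.source ∧ ∃ Q : E →L[ℝ] F,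
      finrank ℝ (LinearMap.ker (Q : E →ₗ[ℝ] F)) = finrank ℝ E + 2 * p - 2 * finrank ℂ F ∧
      (∀ z ∈ e.source, z ∈ φ ⁻¹' P ↔ Q (e z) = 0) ∧
      ∃ ψ : N → F, ContMDiffAt 𝓘(ℝ, F) 𝓘(ℝ, F) ∞ ψ (φ x) ∧
        (∀ᶠ y in 𝓝 (φ x), MDifferentiableAt 𝓘(ℂ, F) 𝓘(ℂ, F) ψ y) ∧
        ∀ z ∈ e.source, ψ (φ z) = Q (e z) := by
  obtain ⟨e, he, hxe, S, hS, hPe⟩ := hP _ hx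
  have he' := mem_maximalAtlas_restrictScalars he
  obtain ⟨e', he', hxe', hee, T, hT, hTe⟩ := exists_chart_comp_eq_linear hφ (hsub x) he' hxe
  obtain ⟨S', hSS'⟩ := S.exists_isCompl
  -- The projection along `S` onto a complex complement is complex linear with kernel `S`, so `pr ∘
  -- e` is a holomorphic defining map for `P`.
  set pr : F →L[ℂ] F := LinearMap.toContinuousLinearMap (S'.projection S hSS'.symm) with hpr
  have hker : ∀ u, pr u = 0 ↔ u ∈ S := fun u ↦ by
    rw [← Submodule.ker_projection hSS'.symm]
    rfl
  set Q : E →L[ℝ] F := (pr.restrictScalars ℝ) ∘L T with hQ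
  have hψh : ∀ y ∈ e.source, ContMDiffAt 𝓘(ℂ, F) 𝓘(ℂ, F) ω (pr ∘ e) y := fun y hy ↦
    pr.contMDiff.contMDiffAt.comp y (contMDiffAt_of_mem_maximalAtlas he hy)
  refine ⟨e', he', hxe', Q, ?_, ?_, pr ∘ e, ?_, ?_, ?_⟩
  · have hk : LinearMap.ker (Q : E →ₗ[ℝ] F)
        = (S.restrictScalars ℝ).comap (T : E →ₗ[ℝ] F) := by
      ext v
      exact hker (T v)
    -- The kernel of `Q` and the subspace `S` have the same real codimension, in `E` and in `F`,
    -- since `T` is surjective. Adding `2 * p` before subtracting keeps the natural subtraction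
    -- exact.
    have h1 := Submodule.finrank_quotient_add_finrank (S.restrictScalars ℝ)
    have h2 := ((S.restrictScalars ℝ).mkQ ∘ₗ (T : E →ₗ[ℝ] F)).finrank_range_add_finrank_ker
    have h3 : LinearMap.ker ((S.restrictScalars ℝ).mkQ ∘ₗ (T : E →ₗ[ℝ] F))
        = (S.restrictScalars ℝ).comap (T : E →ₗ[ℝ] F) := by
      rw [LinearMap.ker_comp, Submodule.ker_mkQ]
    have h4 : LinearMap.range ((S.restrictScalars ℝ).mkQ ∘ₗ (T : E →ₗ[ℝ] F)) = ⊤ :=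
      LinearMap.range_eq_top.2 ((Submodule.mkQ_surjective _).comp hT)
    have h5 : finrank ℝ (S.restrictScalars ℝ) = 2 * p := by
      rw [← hS]
      exact finrank_real_of_complex S
    have h6 := finrank_real_of_complex F
    rw [h3, h4, finrank_top] at h2
    rw [hk]
    omega
  · intro z hz
    rw [Set.mem_preimage, hPe _ (hee z hz), hTe z hz, ← hker]
    rfl
  · exact ((pr.restrictScalars ℝ).contMDiff (n := ∞)).contMDiffAt.comp (φ x)
      (contMDiffAt_of_mem_maximalAtlas (mem_maximalAtlas_restrictScalars he) hxe)
  · exact (e.open_source.eventually_mem hxe).mono fun y hy ↦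
      (hψh y hy).mdifferentiableAt (by simp)
  · intro z hz
    change pr (e (φ z)) = pr (T (e' z))
    rw [hTe z hz]

/-- The preimage of a complex submanifold under a submersion is a submanifold. -/
theorem isEmbeddedSubmanifold_preimage {φ : M → N}
    (hφ : ContMDiff 𝓘(ℝ, E) 𝓘(ℝ, F) ∞ φ) (hsub : IsSubmersionMap (E := E) (F := F) φ)
    {P : Set N} {p : ℕ} (hP : IsEmbeddedSubmanifold ℂ (E := F) ω P p) :
    IsEmbeddedSubmanifold ℝ (E := E) ∞ (φ ⁻¹' P) (finrank ℝ E + 2 * p - 2 * finrank ℂ F) := by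
  intro x hx
  obtain ⟨e, he, hxe, Q, hQ, hK, -⟩ :=
    exists_chart_comp_eq_linear_of_isEmbeddedSubmanifold hφ hsub hP hx
  exact ⟨e, he, hxe, _, hQ, hK⟩

variable [RiemannianBundle (fun x : M ↦ TangentSpace 𝓘(ℝ, E) x)]
  [IsContMDiffRiemannianBundle 𝓘(ℝ, E) ∞ E (fun x : M ↦ TangentSpace 𝓘(ℝ, E) x)]
  [RiemannianBundle (fun y : N ↦ TangentSpace 𝓘(ℝ, F) y)]
  [IsContMDiffRiemannianBundle 𝓘(ℝ, F) ∞ F (fun y : N ↦ TangentSpace 𝓘(ℝ, F) y)]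

/-- For a holomorphic `ψ`, the differential of `ψ` takes the tension field of a pseudo-horizontally
homothetic submersion `φ` to the trace of the Hessian of `ψ ∘ φ` over the kernel of its
differential. -/
theorem mvfderiv_tensionField (hN : IsKahler F N) {φ : M → N}
    (hφ : ContMDiff 𝓘(ℝ, E) 𝓘(ℝ, F) ∞ φ) (hsub : IsSubmersionMap (E := E) (F := F) φ)
    (hPHH : IsPHH (E := E) (F := F) φ) {ψ : N → F} {x : M}
    (hψ : ContMDiffAt 𝓘(ℝ, F) 𝓘(ℝ, F) ∞ ψ (φ x))
    (hψ' : ∀ᶠ y in 𝓝 (φ x), MDifferentiableAt 𝓘(ℂ, F) 𝓘(ℂ, F) ψ y)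
    (hf : ContMDiffAt 𝓘(ℝ, E) 𝓘(ℝ, F) ∞ (ψ ∘ φ) x)
    {C : Submodule ℝ (TangentSpace 𝓘(ℝ, E) x)}
    (hC : ∀ u, u ∈ C ↔ mvfderiv 𝓘(ℝ, E) (ψ ∘ φ) x u = 0) :
    mvfderiv 𝓘(ℝ, F) ψ (φ x) (tensionField (E := E) (F := F) φ x) = traceOn (hess hf) C := by
  have hφ' : ∀ z, MDifferentiableAt 𝓘(ℝ, E) 𝓘(ℝ, F) φ z := fun z ↦ hφ.mdifferentiableAt (by simp)
  have hψr : ∀ᶠ y in 𝓝 (φ x), MDifferentiableAt 𝓘(ℝ, F) 𝓘(ℝ, F) ψ y :=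
    hψ'.mono fun y hy ↦ hy.complexToReal
  have hf' : ∀ᶠ z in 𝓝 x, MDifferentiableAt 𝓘(ℝ, E) 𝓘(ℝ, F) (ψ ∘ φ) z :=
    (hφ.continuous.continuousAt.eventually hψr).mono fun z hz ↦ hz.comp z (hφ' z)
  set D : TangentSpace 𝓘(ℝ, E) x →ₗ[ℝ] TangentSpace 𝓘(ℝ, F) (φ x) :=
    (mfderiv 𝓘(ℝ, E) 𝓘(ℝ, F) φ x : TangentSpace 𝓘(ℝ, E) x →ₗ[ℝ] TangentSpace 𝓘(ℝ, F) (φ x))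
    with hD
  have hDs : Function.Surjective D := hsub x
  have hDJ : ∀ u, D (D.adjoint (complexStructure (φ x) u))
      = complexStructure (φ x) (D (D.adjoint u)) := (hPHH x).1
  set β := (hess hψ).compl₁₂ D D with hβ
  have h1 : mvfderiv 𝓘(ℝ, F) ψ (φ x) (tensionField (E := E) (F := F) φ x)
      = ∑ i, hess hf (stdOrthonormalBasis ℝ (TangentSpace 𝓘(ℝ, E) x) i)
          (stdOrthonormalBasis ℝ (TangentSpace 𝓘(ℝ, E) x) i)
        - ∑ i, β (stdOrthonormalBasis ℝ (TangentSpace 𝓘(ℝ, E) x) i)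
          (stdOrthonormalBasis ℝ (TangentSpace 𝓘(ℝ, E) x) i) := by
    rw [tensionField, map_sum, ← Finset.sum_sub_distrib]
    exact Finset.sum_congr rfl fun i _ ↦ mvfderiv_mapSecondFundamentalForm hφ hψ hψr hf _ _
  -- `C` is `D⁻¹ (ker dψ)`, and `ker dψ` is `J`-invariant as `ψ` is holomorphic.
  have h2 : traceOn (hess hf) Cᗮ = 0 := by
    have hCc : C = (LinearMap.ker (mvfderiv 𝓘(ℝ, F) ψ (φ x) :
        TangentSpace 𝓘(ℝ, F) (φ x) →ₗ[ℝ] F)).comap D := by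
      ext u
      rw [hC, mvfderiv_comp_apply' hψr.self_of_nhds (hφ' x)]
      rfl
    rw [hCc]
    refine traceOn_orthogonal_comap_eq_zero hDs (complexStructure_complexStructure (φ x))
      (hN.1 (φ x)) hDJ (hess_symm hf hf')
      (fun v hv a ↦ hess_comp_adjointDifferential hφ hPHH hψ' hf hv a) fun c hc ↦ ?_
    have hc' : mvfderiv 𝓘(ℝ, F) ψ (φ x) c = 0 := hc
    change mvfderiv 𝓘(ℝ, F) ψ (φ x) (complexStructure (φ x) c) = 0
    rw [mvfderiv_complexStructure hψ'.self_of_nhds, hc', smul_zero]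
  -- Split `T_x M` into `ker D = D⁻¹ ⊥`, where `β` is zero, and the horizontal space, where `β`
  -- inherits complex linearity from `Hess ψ`.
  have h3 : ∑ i, β (stdOrthonormalBasis ℝ (TangentSpace 𝓘(ℝ, E) x) i)
      (stdOrthonormalBasis ℝ (TangentSpace 𝓘(ℝ, E) x) i) = 0 := by
    rw [sum_bilin_eq_traceOn_add_traceOn_orthogonal β _ ((⊥ : Submodule ℝ _).comap D),
      traceOn_orthogonal_comap_eq_zero hDs (complexStructure_complexStructure (φ x))
        (hN.1 (φ x)) hDJ (fun u v ↦ hess_symm hψ hψr _ _) (fun v _ a ↦ ?_)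
        (fun c hc ↦ by rw [Submodule.mem_bot] at hc; simp [hc]),
      traceOn_eq_zero_of_forall, add_zero]
    · intro u hu
      have hu' : D u = 0 := hu
      simp [hβ, hu']
    · change hess hψ (D v) (D (D.adjoint (complexStructure (φ x) a)))
        = Complex.I • hess hψ (D v) (D (D.adjoint a))
      rw [hDJ, hess_complexStructure hN hψ hψ']
  rw [h1, h3, sub_zero, sum_bilin_eq_traceOn_add_traceOn_orthogonal (hess hf) _ C, h2, add_zero]

end Preimage

end VMinimal

end

/-! ### The main theorem -/

theorem theorem3p7
    {E : Type*} [NormedAddCommGroup E] [NormedSpace ℝ E] [FiniteDimensional ℝ E]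
    {M : Type*} [TopologicalSpace M] [ChartedSpace E M] [IsManifold 𝓘(ℝ, E) ∞ M]
    [RiemannianBundle (fun x : M ↦ TangentSpace 𝓘(ℝ, E) x)]
    [IsContMDiffRiemannianBundle 𝓘(ℝ, E) ∞ E (fun x : M ↦ TangentSpace 𝓘(ℝ, E) x)]
    {F : Type*} [NormedAddCommGroup F] [NormedSpace ℂ F] [FiniteDimensional ℂ F]
    {N : Type*} [TopologicalSpace N] [ChartedSpace F N]
    [IsManifold 𝓘(ℂ, F) ω N] [IsManifold 𝓘(ℝ, F) ∞ N]
    [RiemannianBundle (fun y : N ↦ TangentSpace 𝓘(ℝ, F) y)]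
    [IsContMDiffRiemannianBundle 𝓘(ℝ, F) ∞ F (fun y : N ↦ TangentSpace 𝓘(ℝ, F) y)]
    (hN : VMinimal.IsKahler F N)
    (V : Π x : M, TangentSpace 𝓘(ℝ, E) x)
    (hV : ContMDiff 𝓘(ℝ, E) (𝓘(ℝ, E).prod 𝓘(ℝ, E)) ∞
      (fun x ↦ (⟨x, V x⟩ : TangentBundle 𝓘(ℝ, E) M)))
    (φ : M → N) (hφ : ContMDiff 𝓘(ℝ, E) 𝓘(ℝ, F) ∞ φ)
    (hsub : VMinimal.IsSubmersionMap (E := E) (F := F) φ)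
    (hPHH : VMinimal.IsPHH (E := E) (F := F) φ)
    (hharm : VMinimal.IsVHarmonic (F := F) V φ)
    (P : Set N) (p : ℕ) (hP : VMinimal.IsEmbeddedSubmanifold ℂ (E := F) ω P p) :
    VMinimal.IsVMinimalSubmanifold V (φ ⁻¹' P)
      (finrank ℝ E + 2 * p - 2 * finrank ℂ F) := by
  refine ⟨VMinimal.isEmbeddedSubmanifold_preimage hφ hsub hP, fun x hx ↦ ?_⟩
  obtain ⟨e, he, hxe, Q, -, hK, ψ, hψ, hψ', hψQ⟩ :=
    VMinimal.exists_chart_comp_eq_linear_of_isEmbeddedSubmanifold hφ hsub hP hx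
  have hf : ContMDiffAt 𝓘(ℝ, E) 𝓘(ℝ, F) ∞ (ψ ∘ φ) x := hψ.comp x hφ.contMDiffAt
  -- In this chart `f = ψ ∘ φ` is the linear map `Q`, so `ker df` is the tangent space of `K` at
  -- every nearby point of `K`.
  have hd : ∀ y ∈ e.source, ∀ u, mvfderiv 𝓘(ℝ, E) (ψ ∘ φ) y u
      = Q (mfderiv 𝓘(ℝ, E) 𝓘(ℝ, E) e y u) := by
    intro y hy u
    have h1 : ψ ∘ φ =ᶠ[𝓝 y] Q ∘ e := (e.open_source.eventually_mem hy).mono hψQ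
    have h2 : mfderiv 𝓘(ℝ, E) 𝓘(ℝ, F) (Q ∘ e) y = _ :=
      mfderiv_comp y (I' := 𝓘(ℝ, E)) Q.differentiableAt.mdifferentiableAt
        ((VMinimal.mdifferentiable_of_mem_maximalAtlas he).mdifferentiableAt hy)
    rw [mfderiv_eq_fderiv, Q.fderiv] at h2
    exact congrArg (fun L : E →L[ℝ] F ↦ L u) (h1.mfderiv_eq.trans h2)
  have hfK : ∀ y ∈ e.source, y ∈ φ ⁻¹' P → ∀ u, u ∈ VMinimal.tangentSubspace (φ ⁻¹' P) y ↔
      mvfderiv 𝓘(ℝ, E) (ψ ∘ φ) y u = 0 := fun y hy hyK u ↦ by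
    rw [VMinimal.mem_tangentSubspace_iff he hK hy hyK, hd y hy]
  have hfK' : ∀ᶠ y in 𝓝[φ ⁻¹' P] x, ∀ u ∈ VMinimal.tangentSubspace (φ ⁻¹' P) y,
      mvfderiv 𝓘(ℝ, E) (ψ ∘ φ) y u = 0 := by
    filter_upwards [nhdsWithin_le_nhds (e.open_source.eventually_mem hxe), self_mem_nhdsWithin]
      with y hy hyK u hu
    exact (hfK y hy hyK u).1 hu
  have hA : mvfderiv 𝓘(ℝ, E) (ψ ∘ φ) x (VMinimal.traceSecondFundamentalForm (φ ⁻¹' P) x)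
      = -VMinimal.traceOn (VMinimal.hess hf) (VMinimal.tangentSubspace (φ ⁻¹' P) x) := by
    rw [VMinimal.traceSecondFundamentalForm, map_sum, VMinimal.traceOn, ← Finset.sum_neg_distrib]
    exact Finset.sum_congr rfl fun i _ ↦ VMinimal.mvfderiv_secondFundamentalForm he hK hxe hx hf
      hfK' (Submodule.coe_mem _) (Submodule.coe_mem _)
  have hτ := VMinimal.mvfderiv_tensionField hN hφ hsub hPHH hψ hψ' hf (hfK x hxe hx)
  -- `V`-harmonicity replaces `dφ(V)` by `-τ(φ)`, so `df` takes the same value on `V` as on the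
  -- trace of `A`.
  have hVx : mvfderiv 𝓘(ℝ, E) (ψ ∘ φ) x (V x)
      = -VMinimal.traceOn (VMinimal.hess hf) (VMinimal.tangentSubspace (φ ⁻¹' P) x) := by
    rw [VMinimal.mvfderiv_comp_apply' (hψ.mdifferentiableAt (by simp))
      (hφ.mdifferentiableAt (by simp)), ← hτ, ← map_neg]
    exact congrArg _ (eq_neg_of_add_eq_zero_right (hharm x))
  rw [hfK x hxe hx, map_sub, hA, hVx, sub_self]
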